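/- \textbf{Problem.} In minimum-cost bipartite perfect matching with delays (MBPMD) on the real line, $m$ requests and $m$ servers arrive over time; each such element $u$ has a location $\mathrm{pos}(u)\in\mathbb R$ and an arrival time $a(u)\in\mathbb R$, both revealed at time $a(u)$. A solution is a perfect matching between requests and servers together with a time $t(r,s)\ge\max\{a(r),a(s)\}$ for each matched pair; its cost is $\sum_{(r,s)}\big(|\mathrm{pos}(r)-\mathrm{pos}(s)|+(t(r,s)-a(r))+(t(r,s)-a(s))\big)$. A deterministic online algorithm produces a solution for every input, in such a way that the pairs matched up to any time $t$, with their matching times, are determined by the elements that have arrived up to time $t$; matched pairs are never undone, and $m$ is not known in advance. For a function $c$ with $c(m)\ge 1$, the algorithm is $c(m)$-competitive if, on every input with $m$ requests and $m$ servers, its cost is at most $c(m)$ times the minimum cost of a solution of that input. \textbf{Net-cost.} For a request $r$ and a server $s$ let $D(r,s)=|\mathrm{pos}(r)-\mathrm{pos}(s)|+|a(r)-a(s)|$, the Manhattan distance in the time-augmented plane. For a matching $M$, an $M$-augmenting path is a simple path $P=r_1s_1r_2s_2\cdots r_\ell s_\ell$ ($\ell\ge1$) with all edges $(r_k,s_k)\notin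 M$, all edges $(r_{k+1},s_k)\in M$, and $r_1,s_\ell$ not saturated by $M$. For $\gamma>1$ its $\gamma$-net-cost is $\varphi_\gamma(P)=\gamma\sum_{k=1}^{\ell}D(r_k,s_k)-\sum_{k=1}^{\ell-1}D(r_{k+1},s_k)$. \textbf{Algorithm.} Let $\gamma=3$. The algorithm maintains an offline matching $M^{OFF}$, initially empty. An element is free if it has arrived and is not saturated by $M^{OFF}$. A free request $r$ is ready at time $t$ if there is a free server and $t-a(r)\ge\varphi_\gamma(P)/\gamma$, where $P$ is an $M^{OFF}$-augmenting path of minimum $\gamma$-net-cost among those from $r$ to a free server. As soon as some request is ready, the algorithm selects one ready request $r$, irrevocably matches it, at the current time, to the last server of such a minimum path $P$, and replaces $M^{OFF}$ by its symmetric difference with the edge set of $P$; this is repeated as long as some request is ready. Ties are broken arbitrarily, and elements that arrive at time $t$ are taken into account before the augmentations at time $t$. \textbf{Theorem.} There is a deterministic online algorithm for MBPMD on the real line, every run of which is an execution of the algorithm just described, that is $c(m)$-competitive for some function $c$ with $c(m)=O(\sqrt m\,\log^2 m)$ as $m\to\infty$. -/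

import Mathlib

open scoped BigOperators

noncomputable section

namespace MBPMD

/-- An input of minimum-cost bipartite perfect matching with delays on the real line:
`m` requests and `m` servers, each with a location on the line and an arrival time.
The elements are labelled `0, …, m - 1` in an arbitrary order. -/
structure Instance (m : ℕ) where
  reqPos : Fin m → ℝ
  reqTime : Fin m → ℝ
  srvPos : Fin m → ℝ
  srvTime : Fin m → ℝ

/-- A solution: a perfect matching between requests and servers (request `r` is matched to
`server r`) and, for each of its edges, a matching time (`time r`, for the edge at `r`) which is
not before the arrival of either endpoint. -/
structure Solution {m : ℕ} (I : Instance m) where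
  server : Equiv.Perm (Fin m)
  time : Fin m → ℝ
  reqTime_le : ∀ r, I.reqTime r ≤ time r
  srvTime_le : ∀ r, I.srvTime (server r) ≤ time r

/-- The total distance and delay cost of a solution. -/
def Solution.cost {m : ℕ} {I : Instance m} (S : Solution I) : ℝ :=
  ∑ r : Fin m, (|I.reqPos r - I.srvPos (S.server r)|
    + (S.time r - I.reqTime r) + (S.time r - I.srvTime (S.server r)))

theorem Solution.cost_nonneg {m : ℕ} {I : Instance m} (S : Solution I) : 0 ≤ S.cost :=
  Finset.sum_nonneg fun r _ =>
    add_nonneg (add_nonneg (abs_nonneg _) (sub_nonneg.2 (S.reqTime_le r)))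
      (sub_nonneg.2 (S.srvTime_le r))

instance {m : ℕ} (I : Instance m) : Nonempty (Solution I) :=
  ⟨⟨Equiv.refl _, fun r => max (I.reqTime r) (I.srvTime r),
    fun _ => le_max_left _ _, fun _ => le_max_right _ _⟩⟩

/-- The cost of an optimal offline solution (an infimum of a nonempty set of nonnegative reals). -/
def Instance.optCost {m : ℕ} (I : Instance m) : ℝ := ⨅ S : Solution I, S.cost

/-- What is revealed about the requests by time `t`: label, location and arrival time of every
request that has arrived. -/
def Instance.revealedRequests {m : ℕ} (I : Instance m) (t : ℝ) : Set (ℕ × ℝ × ℝ) :=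
  {x | ∃ r : Fin m, I.reqTime r ≤ t ∧ x = ((r : ℕ), I.reqPos r, I.reqTime r)}

/-- What is revealed about the servers by time `t`. -/
def Instance.revealedServers {m : ℕ} (I : Instance m) (t : ℝ) : Set (ℕ × ℝ × ℝ) :=
  {x | ∃ s : Fin m, I.srvTime s ≤ t ∧ x = ((s : ℕ), I.srvPos s, I.srvTime s)}

/-- What a solution has done by time `t`: the edges that have been matched (request label, server
label), with their matching times. -/
def Solution.decisions {m : ℕ} {I : Instance m} (S : Solution I) (t : ℝ) : Set (ℕ × ℕ × ℝ) :=
  {x | ∃ r : Fin m, S.time r ≤ t ∧ x = ((r : ℕ), (S.server r : ℕ), S.time r)}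

/-- A deterministic online algorithm: it produces a solution for every input, and what it does up
to time `t` is determined by the elements that have arrived up to time `t`. In particular it does
not know the number `m` of requests in advance. -/
structure OnlineAlgorithm where
  run : ∀ {m : ℕ} (I : Instance m), Solution I
  causal : ∀ {m m' : ℕ} (I : Instance m) (I' : Instance m') (t : ℝ),
    I.revealedRequests t = I'.revealedRequests t →
    I.revealedServers t = I'.revealedServers t →
    (run I).decisions t = (run I').decisions t

/-- The algorithm is `c m`-competitive on the inputs with `m` requests, for every `m`. -/
def OnlineAlgorithm.IsCompetitive (A : OnlineAlgorithm) (c : ℕ → ℝ) : Prop :=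
  ∀ m : ℕ, 1 ≤ c m ∧ ∀ I : Instance m, (A.run I).cost ≤ c m * I.optCost

/-- The Manhattan distance between a request and a server in the time-augmented plane. -/
def Instance.dist {m : ℕ} (I : Instance m) (r s : Fin m) : ℝ :=
  |I.reqPos r - I.srvPos s| + |I.reqTime r - I.srvTime s|

/-- A directed path `r₁ s₁ r₂ s₂ ⋯ r_ℓ s_ℓ` that starts at a request and ends at a server, written
as the list `[(r₁, s₁), …, (r_ℓ, s_ℓ)]` of its request-to-server edges. -/
abbrev AltPath (m : ℕ) := List (Fin m × Fin m)

/-- The server-to-request edges `s_k → r_{k+1}`, each written as the pair `(r_{k+1}, s_k)`. -/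
def AltPath.backEdges {m : ℕ} (P : AltPath m) : List (Fin m × Fin m) :=
  List.zip (P.tail.map Prod.fst) (P.map Prod.snd)

/-- The set of undirected edges of the path. -/
def AltPath.edges {m : ℕ} (P : AltPath m) : Finset (Fin m × Fin m) :=
  P.toFinset ∪ (AltPath.backEdges P).toFinset

/-- The first request of the path. -/
def AltPath.origin? {m : ℕ} (P : AltPath m) : Option (Fin m) := P.head?.map Prod.fst

/-- The last server of the path. -/
def AltPath.terminus? {m : ℕ} (P : AltPath m) : Option (Fin m) := P.getLast?.map Prod.snd

/-- The `γ`-net-cost of the path in the time-augmented plane. -/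
def Instance.netCost {m : ℕ} (I : Instance m) (γ : ℝ) (P : AltPath m) : ℝ :=
  γ * (P.map fun e => I.dist e.1 e.2).sum
    - ((AltPath.backEdges P).map fun e => I.dist e.1 e.2).sum

/-- A request is free at time `t` with respect to the matching `M` if it has arrived and is not
saturated by `M`. -/
def Instance.FreeRequest {m : ℕ} (I : Instance m) (M : Finset (Fin m × Fin m)) (t : ℝ)
    (r : Fin m) : Prop :=
  I.reqTime r ≤ t ∧ ∀ e ∈ M, e.1 ≠ r

/-- A server is free at time `t` with respect to the matching `M` if it has arrived and is not
saturated by `M`. -/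
def Instance.FreeServer {m : ℕ} (I : Instance m) (M : Finset (Fin m × Fin m)) (t : ℝ)
    (s : Fin m) : Prop :=
  I.srvTime s ≤ t ∧ ∀ e ∈ M, e.2 ≠ s

/-- `P` is an `M`-augmenting path from the free request `r` to a server that is free at
time `t`: no vertex is repeated, and the edges are alternately outside and inside `M`. -/
structure Instance.IsAugPath {m : ℕ} (I : Instance m) (M : Finset (Fin m × Fin m)) (t : ℝ)
    (r : Fin m) (P : AltPath m) : Prop where
  origin_eq : AltPath.origin? P = some r
  free_origin : I.FreeRequest M t r
  free_terminus : ∃ s, AltPath.terminus? P = some s ∧ I.FreeServer M t s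
  nodup_requests : (P.map Prod.fst).Nodup
  nodup_servers : (P.map Prod.snd).Nodup
  notMem : ∀ e ∈ P, e ∉ M
  mem : ∀ e ∈ AltPath.backEdges P, e ∈ M

/-- `P` has the minimum `γ`-net-cost among the `M`-augmenting paths from `r` to a server that is
free at time `t`. -/
def Instance.IsMinAugPath {m : ℕ} (I : Instance m) (γ : ℝ) (M : Finset (Fin m × Fin m)) (t : ℝ)
    (r : Fin m) (P : AltPath m) : Prop :=
  I.IsAugPath M t r P ∧ ∀ Q : AltPath m, I.IsAugPath M t r Q → I.netCost γ P ≤ I.netCost γ Q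

/-- The request `r` is ready at time `t`, with minimum augmenting path `P`: it is free, and its
waiting time is at least its minimum `γ`-net-cost divided by `γ`. -/
def Instance.IsReady {m : ℕ} (I : Instance m) (γ : ℝ) (M : Finset (Fin m × Fin m)) (t : ℝ)
    (r : Fin m) (P : AltPath m) : Prop :=
  I.IsMinAugPath γ M t r P ∧ I.netCost γ P / γ ≤ t - I.reqTime r

/-- The solution `S` is an execution of the robust matching algorithm with delays. The algorithm
maintains an offline matching, initially empty. As soon as some request is ready, one of the ready
requests is matched to the last server of a minimum augmenting path of it, and the offline matching
is augmented by that path; this is repeated while there are ready requests.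
Here `off k` is the offline matching after `k` augmentations, and `req k` and `path k` are the
request that is processed next and its path, for `k = 0, …, m - 1`. -/
structure Execution {m : ℕ} (γ : ℝ) (I : Instance m) (S : Solution I) where
  req : Fin m → Fin m
  path : Fin m → AltPath m
  off : ℕ → Finset (Fin m × Fin m)
  off_zero : off 0 = ∅
  off_succ : ∀ k : Fin m, off (k + 1) = symmDiff (off k) (AltPath.edges (path k))
  time_mono : ∀ j k : Fin m, j ≤ k → S.time (req j) ≤ S.time (req k)
  ready : ∀ k : Fin m, I.IsReady γ (off k) (S.time (req k)) (req k) (path k)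
  terminus : ∀ k : Fin m, AltPath.terminus? (path k) = some (S.server (req k))
  /-- No request is ready strictly between two consecutive augmentations, nor at the time of the
  earlier one (after it) if the later one happens at a later time. -/
  prompt : ∀ (k : Fin m) (t : ℝ), (∀ j : Fin m, j < k → S.time (req j) ≤ t) →
    t < S.time (req k) → ∀ (r : Fin m) (P : AltPath m), ¬ I.IsReady γ (off k) t r P

end MBPMD

end

/-! Everything is charged to the total waiting time of the requests. When a request with waiting
time `w` is processed along a path with forward length F and back length B, readiness gives 3F − B ≤
3w. The matched pair is at distance at most F + B = (3F − B) − 2(F − B), and F − B is the change in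
the length of the offline matching, so summation telescopes and the distances total at most 3Σw
(`Execution.sum_dist_le`). The cost is then at most 5Σw.

Waiting times are bounded by linear programming duality. The offline matching carries feasible duals
in which a free request has γ times its waiting time and a free server has 0 (`IsDual.augment`,
`IsDual.grow`). Fix a reference perfect matching σ. From each free request, follow alternately σ and
the offline matching until a free server is reached. These paths are vertex-disjoint. Telescoping
the dual constraints along them shows that such a path stays within 4 times its own σ-weight of its
start, and that this weight plus the distance to any free request `r` is at least the waiting time
of `r` (`IsDual.exists_alternating_sets`).

The rest is packing in the plane (`card_le_of_disjoint_nearby`, `AlternatingFamily.scale_bound`).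
Normalize the σ-weight to 1 and consider requests with waiting time about δ. In each grid cell of
side δ/16, freeze the picture when the first of them is processed: all the others are still free, so
each owns a disjoint path of σ-weight at least of order δ. Sort these paths by weight ρ. In a cell
of side ρ with nearby weight V there are about (ρ/δ)² fine cells, each holding at most about V/ρ
requests, so the count c satisfies δ²c ≲ ρV; also c ≤ m and ρ ≲ V. Multiplying, δc ≲ √m · V, and the
values V sum to O(1). There are O(log m) weights ρ for each of O(log m) scales δ, which gives √m
log² m.

Finally the algorithm must be constructed and shown to be online: the next augmentation time is the
least element of a closed half-line, ties are broken by labels, and each step depends only on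
elements that have already arrived (`Instance.Agree.decisions_eq`). -/

namespace MBPMD

variable {m m' : ℕ}

/-! ### Alternating paths as lists of forward edges. -/

namespace AltPath

theorem backEdges_cons_cons (a b : Fin m × Fin m) (P : AltPath m) :
    backEdges (a :: b :: P) = (b.1, a.2) :: backEdges (b :: P) := rfl

/-- Every request of the path except the first is entered through a back edge. Since back edges lie
in the offline matching, this locates every vertex of the path: an endpoint, or saturated. -/
theorem origin?_or_backEdges (P : AltPath m) :
    ∀ e ∈ P, origin? P = some e.1 ∨ ∃ f ∈ backEdges P, f.1 = e.1 := by
  induction P with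
  | nil => simp
  | cons a P ih =>
    intro e he
    rcases List.mem_cons.1 he with rfl | he
    · exact Or.inl rfl
    · right
      cases P with
      | nil => simp at he
      | cons b P =>
        rw [backEdges_cons_cons]
        rcases ih e he with h | ⟨f, hf, h⟩
        · exact ⟨_, List.mem_cons_self, by simpa [origin?] using h⟩
        · exact ⟨f, List.mem_cons_of_mem _ hf, h⟩

theorem terminus?_or_backEdges (P : AltPath m) :
    ∀ e ∈ P, terminus? P = some e.2 ∨ ∃ f ∈ backEdges P, f.2 = e.2 := by
  induction P with
  | nil => simp
  | cons a P ih =>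
    intro e he
    cases P with
    | nil => simp at he; subst he; exact Or.inl rfl
    | cons b P =>
      rw [backEdges_cons_cons]
      rcases List.mem_cons.1 he with rfl | he
      · exact Or.inr ⟨_, List.mem_cons_self, rfl⟩
      · rcases ih e he with h | ⟨f, hf, h⟩
        · left; simpa [terminus?] using h
        · exact Or.inr ⟨f, List.mem_cons_of_mem _ hf, h⟩

theorem exists_mem_of_mem_backEdges {P : AltPath m} {f : Fin m × Fin m} (hf : f ∈ backEdges P) :
    (∃ e ∈ P, e.1 = f.1) ∧ ∃ e ∈ P, e.2 = f.2 := by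
  obtain ⟨h1, h2⟩ := List.of_mem_zip (a := f.1) (b := f.2) hf
  obtain ⟨a, ha, h⟩ := List.mem_map.1 h1
  obtain ⟨b, hb, h'⟩ := List.mem_map.1 h2
  exact ⟨⟨a, List.mem_of_mem_tail ha, h⟩, ⟨b, hb, h'⟩⟩

theorem mem_backEdges_append (P Q : AltPath m) :
    ∀ f ∈ backEdges P, f ∈ backEdges (P ++ Q) := by
  induction P with
  | nil => simp [backEdges]
  | cons a P ih =>
    cases P with
    | nil => simp [backEdges]
    | cons b P =>
      intro f hf
      rw [backEdges_cons_cons] at hf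
      rw [List.cons_append, List.cons_append, backEdges_cons_cons]
      rcases List.mem_cons.1 hf with rfl | hf
      · exact List.mem_cons_self
      · exact List.mem_cons_of_mem _ (ih f hf)

theorem mem_backEdges_concat (P : AltPath m) (e : Fin m × Fin m) :
    ∀ f ∈ backEdges (P ++ [e]), f ∈ backEdges P ∨ ∃ s, terminus? P = some s ∧ f = (e.1, s) := by
  induction P with
  | nil => simp [backEdges]
  | cons a P ih =>
    cases P with
    | nil => simp [backEdges, terminus?]
    | cons b P =>
      intro f hf
      rw [List.cons_append, List.cons_append, backEdges_cons_cons] at hf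
      rw [backEdges_cons_cons]
      rcases List.mem_cons.1 hf with rfl | hf
      · exact Or.inl List.mem_cons_self
      · rcases ih f hf with h | ⟨s, hs, h⟩
        · exact Or.inl (List.mem_cons_of_mem _ h)
        · exact Or.inr ⟨s, by simpa [terminus?] using hs, h⟩

theorem exists_mem_origin {P : AltPath m} {r : Fin m} (h : origin? P = some r) :
    ∃ e ∈ P, e.1 = r := by
  cases P with
  | nil => simp [origin?] at h
  | cons a P => exact ⟨a, List.mem_cons_self, by simpa [origin?] using h⟩

theorem exists_mem_terminus {P : AltPath m} {s : Fin m} (h : terminus? P = some s) :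
    ∃ e ∈ P, e.2 = s := by
  obtain ⟨e, he, h⟩ := Option.map_eq_some_iff.1 h
  exact ⟨e, List.mem_of_getLast? he, h⟩

theorem backEdges_nodup {P : AltPath m} (h : (P.map Prod.fst).Nodup) : (backEdges P).Nodup := by
  refine List.Nodup.of_map Prod.fst ?_
  unfold backEdges
  rw [List.map_fst_zip (by simp), List.map_tail]
  exact h.tail

/-- Summing reduced costs along a path telescopes. -/
theorem sum_backEdges_telescope (yr ys : Fin m → ℝ) (P : AltPath m) :
    ∀ r s, origin? P = some r → terminus? P = some s →
      (P.map fun e => yr e.1 + ys e.2).sum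
        = ((backEdges P).map fun e => yr e.1 + ys e.2).sum + yr r + ys s := by
  induction P with
  | nil => simp [origin?]
  | cons a P ih =>
    intro r s hr hs
    have hr' : a.1 = r := by simpa [origin?] using hr
    cases P with
    | nil =>
      have hs' : a.2 = s := by simpa [terminus?] using hs
      simp [backEdges, hr', hs']
    | cons b P =>
      have := ih b.1 s rfl (by simpa [terminus?] using hs)
      rw [List.map_cons, List.sum_cons, this, backEdges_cons_cons, List.map_cons, List.sum_cons,
        hr']
      ring

end AltPath

/-! ### Matchings and the effect of an augmentation. -/

/-- Distinct edges of `M` share no endpoint. -/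
structure IsMatching (M : Finset (Fin m × Fin m)) : Prop where
  fst_inj : ∀ e ∈ M, ∀ f ∈ M, e.1 = f.1 → e = f
  snd_inj : ∀ e ∈ M, ∀ f ∈ M, e.2 = f.2 → e = f

theorem isMatching_empty : IsMatching (∅ : Finset (Fin m × Fin m)) := ⟨by simp, by simp⟩

/-- The timeless part of the definition of an augmenting path. -/
structure IsAlternating (M : Finset (Fin m × Fin m)) (r s : Fin m) (P : AltPath m) : Prop where
  origin_eq : AltPath.origin? P = some r
  terminus_eq : AltPath.terminus? P = some s
  origin_free : ∀ e ∈ M, e.1 ≠ r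
  nodup_requests : (P.map Prod.fst).Nodup
  nodup_servers : (P.map Prod.snd).Nodup
  notMem : ∀ e ∈ P, e ∉ M
  mem : ∀ e ∈ AltPath.backEdges P, e ∈ M

theorem Instance.isAugPath_iff {I : Instance m} {M : Finset (Fin m × Fin m)} {t : ℝ} {r : Fin m}
    {P : AltPath m} : I.IsAugPath M t r P ↔ ∃ s, IsAlternating M r s P ∧ (∀ e ∈ M, e.2 ≠ s) ∧
      I.reqTime r ≤ t ∧ I.srvTime s ≤ t := by
  constructor
  · rintro ⟨h1, h2, ⟨s, h3, h4⟩, h5, h6, h7, h8⟩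
    exact ⟨s, ⟨h1, h3, h2.2, h5, h6, h7, h8⟩, h4.2, h2.1, h4.1⟩
  · rintro ⟨s, ⟨h1, h2, h3, h4, h5, h6, h7⟩, h8, h9, h10⟩
    exact ⟨h1, ⟨h9, h3⟩, ⟨s, h2, h10, h8⟩, h4, h5, h6, h7⟩

namespace IsAlternating

variable {M : Finset (Fin m × Fin m)} {r s : Fin m} {P : AltPath m}

theorem mem_symmDiff (h : IsAlternating M r s P) (e : Fin m × Fin m) :
    e ∈ symmDiff M (AltPath.edges P) ↔ e ∈ P ∨ (e ∈ M ∧ e ∉ AltPath.backEdges P) := by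
  have h1 := h.notMem e
  have h2 := h.mem e
  simp only [Finset.mem_symmDiff, AltPath.edges, Finset.mem_union, List.mem_toFinset]
  tauto

theorem isMatching_symmDiff (h : IsAlternating M r s P) (hs : ∀ e ∈ M, e.2 ≠ s)
    (hM : IsMatching M) : IsMatching (symmDiff M (AltPath.edges P)) := by
  have key1 : ∀ e ∈ P, ∀ f ∈ M, f ∉ AltPath.backEdges P → e.1 ≠ f.1 := by
    intro e he f hf hf' hef
    rcases AltPath.origin?_or_backEdges P e he with h' | ⟨g, hg, hge⟩
    · rw [h.origin_eq, Option.some_inj] at h'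
      exact h.origin_free f hf (by rw [← hef, h'])
    · exact hf' (hM.fst_inj g (h.mem g hg) f hf (hge.trans hef) ▸ hg)
  have key2 : ∀ e ∈ P, ∀ f ∈ M, f ∉ AltPath.backEdges P → e.2 ≠ f.2 := by
    intro e he f hf hf' hef
    rcases AltPath.terminus?_or_backEdges P e he with h' | ⟨g, hg, hge⟩
    · rw [h.terminus_eq, Option.some_inj] at h'
      exact hs f hf (by rw [← hef, h'])
    · exact hf' (hM.snd_inj g (h.mem g hg) f hf (hge.trans hef) ▸ hg)
  constructor
  · intro e he f hf hef
    rw [h.mem_symmDiff] at he hf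
    rcases he with he | he <;> rcases hf with hf | hf
    · exact List.inj_on_of_nodup_map h.nodup_requests he hf hef
    · exact absurd hef (key1 e he f hf.1 hf.2)
    · exact absurd hef.symm (key1 f hf e he.1 he.2)
    · exact hM.fst_inj e he.1 f hf.1 hef
  · intro e he f hf hef
    rw [h.mem_symmDiff] at he hf
    rcases he with he | he <;> rcases hf with hf | hf
    · exact List.inj_on_of_nodup_map h.nodup_servers he hf hef
    · exact absurd hef (key2 e he f hf.1 hf.2)
    · exact absurd hef.symm (key2 f hf e he.1 he.2)
    · exact hM.snd_inj e he.1 f hf.1 hef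

theorem saturates_request_iff (h : IsAlternating M r s P) (x : Fin m) :
    (∃ e ∈ symmDiff M (AltPath.edges P), e.1 = x) ↔ x = r ∨ ∃ e ∈ M, e.1 = x := by
  simp only [h.mem_symmDiff]
  constructor
  · rintro ⟨e, he | he, rfl⟩
    · rcases AltPath.origin?_or_backEdges P e he with h' | ⟨g, hg, hge⟩
      · rw [h.origin_eq, Option.some_inj] at h'
        exact Or.inl h'.symm
      · exact Or.inr ⟨g, h.mem g hg, hge⟩
    · exact Or.inr ⟨e, he.1, rfl⟩
  · rintro (rfl | ⟨e, he, rfl⟩)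
    · obtain ⟨e, he, h'⟩ := AltPath.exists_mem_origin h.origin_eq
      exact ⟨e, Or.inl he, h'⟩
    · by_cases hb : e ∈ AltPath.backEdges P
      · obtain ⟨f, hf, h'⟩ := (AltPath.exists_mem_of_mem_backEdges hb).1
        exact ⟨f, Or.inl hf, h'⟩
      · exact ⟨e, Or.inr ⟨he, hb⟩, rfl⟩

theorem saturates_server_iff (h : IsAlternating M r s P) (x : Fin m) :
    (∃ e ∈ symmDiff M (AltPath.edges P), e.2 = x) ↔ x = s ∨ ∃ e ∈ M, e.2 = x := by
  simp only [h.mem_symmDiff]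
  constructor
  · rintro ⟨e, he | he, rfl⟩
    · rcases AltPath.terminus?_or_backEdges P e he with h' | ⟨g, hg, hge⟩
      · rw [h.terminus_eq, Option.some_inj] at h'
        exact Or.inl h'.symm
      · exact Or.inr ⟨g, h.mem g hg, hge⟩
    · exact Or.inr ⟨e, he.1, rfl⟩
  · rintro (rfl | ⟨e, he, rfl⟩)
    · obtain ⟨e, he, h'⟩ := AltPath.exists_mem_terminus h.terminus_eq
      exact ⟨e, Or.inl he, h'⟩
    · by_cases hb : e ∈ AltPath.backEdges P
      · obtain ⟨f, hf, h'⟩ := (AltPath.exists_mem_of_mem_backEdges hb).2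
        exact ⟨f, Or.inl hf, h'⟩
      · exact ⟨e, Or.inr ⟨he, hb⟩, rfl⟩

theorem sum_symmDiff (h : IsAlternating M r s P) (D : Fin m × Fin m → ℝ) :
    ∑ e ∈ symmDiff M (AltPath.edges P), D e
      = ∑ e ∈ M, D e + (P.map D).sum - ((AltPath.backEdges P).map D).sum := by
  have hP : P.Nodup := List.Nodup.of_map _ h.nodup_requests
  have hB := AltPath.backEdges_nodup h.nodup_requests
  rw [← List.sum_toFinset D hP, ← List.sum_toFinset D hB]
  have hsub : (AltPath.backEdges P).toFinset ⊆ M := fun e he => h.mem e (List.mem_toFinset.1 he)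
  have : symmDiff M (AltPath.edges P) = P.toFinset ∪ (M \ (AltPath.backEdges P).toFinset) := by
    ext e
    simp [h.mem_symmDiff]
  rw [this, Finset.sum_union, ← Finset.sum_sdiff hsub]
  · ring
  · rw [Finset.disjoint_left]
    intro e he he'
    exact h.notMem e (List.mem_toFinset.1 he) (Finset.mem_sdiff.1 he').1

end IsAlternating

/-! ### Distances in the time-augmented plane, and readiness. -/

theorem Instance.dist_nonneg (I : Instance m) (r s : Fin m) : 0 ≤ I.dist r s :=
  add_nonneg (abs_nonneg _) (abs_nonneg _)

/-- The Manhattan distance between two requests in the time-augmented plane. -/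
def Instance.reqDist (I : Instance m) (r r' : Fin m) : ℝ :=
  |I.reqPos r - I.reqPos r'| + |I.reqTime r - I.reqTime r'|

theorem Instance.reqDist_le (I : Instance m) (r r' s : Fin m) :
    I.reqDist r r' ≤ I.dist r s + I.dist r' s := by
  unfold Instance.reqDist Instance.dist
  have h1 := abs_sub_le (I.reqPos r) (I.srvPos s) (I.reqPos r')
  have h2 := abs_sub_le (I.reqTime r) (I.srvTime s) (I.reqTime r')
  rw [abs_sub_comm (I.srvPos s)] at h1
  rw [abs_sub_comm (I.srvTime s)] at h2
  linarith

theorem Instance.dist_le_reqDist_add (I : Instance m) (r r' s : Fin m) :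
    I.dist r s ≤ I.reqDist r r' + I.dist r' s := by
  unfold Instance.reqDist Instance.dist
  have h1 := abs_sub_le (I.reqPos r) (I.reqPos r') (I.srvPos s)
  have h2 := abs_sub_le (I.reqTime r) (I.reqTime r') (I.srvTime s)
  linarith

theorem Instance.reqDist_triangle (I : Instance m) (r r' r'' : Fin m) :
    I.reqDist r r'' ≤ I.reqDist r r' + I.reqDist r' r'' := by
  unfold Instance.reqDist
  have h1 := abs_sub_le (I.reqPos r) (I.reqPos r') (I.reqPos r'')
  have h2 := abs_sub_le (I.reqTime r) (I.reqTime r') (I.reqTime r'')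
  linarith

/-- The endpoints of a path are no farther apart than its length. -/
theorem Instance.dist_le_length (I : Instance m) (P : AltPath m) :
    ∀ r s, AltPath.origin? P = some r → AltPath.terminus? P = some s →
      I.dist r s ≤ (P.map fun e => I.dist e.1 e.2).sum
        + ((AltPath.backEdges P).map fun e => I.dist e.1 e.2).sum := by
  induction P with
  | nil => simp [AltPath.origin?]
  | cons a P ih =>
    intro r s hr hs
    have hr' : a.1 = r := by simpa [AltPath.origin?] using hr
    cases P with
    | nil =>
      have hs' : a.2 = s := by simpa [AltPath.terminus?] using hs
      simp [AltPath.backEdges, hr', hs']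
    | cons b P =>
      have := ih b.1 s rfl (by simpa [AltPath.terminus?] using hs)
      rw [AltPath.backEdges_cons_cons, List.map_cons, List.sum_cons, List.map_cons, List.map_cons,
        List.sum_cons, List.sum_cons, hr']
      rw [List.map_cons, List.sum_cons] at this
      have h1 := I.dist_le_reqDist_add r b.1 s
      have h2 := I.reqDist_le r b.1 a.2
      dsimp only
      linarith

theorem finite_isAlternating (M : Finset (Fin m × Fin m)) :
    {P : AltPath m | ∃ r s, IsAlternating M r s P}.Finite := by
  have : {P : List (Fin m × Fin m) | P.Nodup}.Finite :=
    Set.finite_coe_iff.1 (inferInstanceAs (Finite {P : List (Fin m × Fin m) // P.Nodup}))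
  refine this.subset ?_
  rintro P ⟨r, s, h⟩
  exact List.Nodup.of_map _ h.nodup_requests

/-- There are finitely many simple paths, so a minimum exists; hence one sufficiently cheap
augmenting path, minimal or not, already makes its request ready. -/
theorem Instance.exists_isReady {I : Instance m} {γ : ℝ} (hγ : 0 < γ)
    {M : Finset (Fin m × Fin m)} {t : ℝ} {r : Fin m} {P : AltPath m} (hP : I.IsAugPath M t r P)
    (h : I.netCost γ P ≤ γ * (t - I.reqTime r)) : ∃ Q, I.IsReady γ M t r Q := by
  have hfin : {Q : AltPath m | I.IsAugPath M t r Q}.Finite := by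
    refine (finite_isAlternating M).subset ?_
    intro Q hQ
    obtain ⟨s, hs, -⟩ := Instance.isAugPath_iff.1 hQ
    exact ⟨r, s, hs⟩
  obtain ⟨Q, hQ, hmin⟩ := Set.exists_min_image _ (I.netCost γ) hfin ⟨P, hP⟩
  refine ⟨Q, ⟨hQ, fun R hR => hmin R hR⟩, ?_⟩
  rw [div_le_iff₀ hγ]
  have := hmin P hP
  linarith

/-! ### Dual variables along the run of the algorithm. -/

/-- Feasible dual variables for the offline matching `M` at time `t`: the dual of a free request
has grown at rate `γ` since its arrival, and no dual of a request has grown faster. -/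
structure IsDual (I : Instance m) (γ : ℝ) (M : Finset (Fin m × Fin m)) (t : ℝ)
    (yr ys : Fin m → ℝ) : Prop where
  add_le : ∀ r s, yr r + ys s ≤ γ * I.dist r s
  add_eq : ∀ e ∈ M, yr e.1 + ys e.2 = I.dist e.1 e.2
  srv_nonpos : ∀ s, ys s ≤ 0
  srv_free : ∀ s, (∀ e ∈ M, e.2 ≠ s) → ys s = 0
  req_free : ∀ r, (∀ e ∈ M, e.1 ≠ r) → yr r = γ * max 0 (t - I.reqTime r)
  req_le : ∀ r, yr r ≤ γ * max 0 (t - I.reqTime r)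

/-- The total slack of the forward edges of a path. -/
def Instance.slack (I : Instance m) (γ : ℝ) (yr ys : Fin m → ℝ) (P : AltPath m) : ℝ :=
  (P.map fun e => γ * I.dist e.1 e.2 - (yr e.1 + ys e.2)).sum

namespace IsDual

variable {I : Instance m} {γ t : ℝ} {M : Finset (Fin m × Fin m)} {yr ys : Fin m → ℝ}

/-- Back edges are tight, so their lengths cancel against the duals of the interior vertices; what
remains is the slack of the forward edges and the duals of the two ends. -/
theorem netCost_eq (hy : IsDual I γ M t yr ys) {r s : Fin m} {P : AltPath m}
    (h : IsAlternating M r s P) : I.netCost γ P = I.slack γ yr ys P + yr r + ys s := by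
  have h1 := AltPath.sum_backEdges_telescope yr ys P r s h.origin_eq h.terminus_eq
  have h2 : ((AltPath.backEdges P).map fun e => I.dist e.1 e.2)
      = (AltPath.backEdges P).map fun e => yr e.1 + ys e.2 :=
    List.map_congr_left fun e he => (hy.add_eq e (h.mem e he)).symm
  have h3 : I.slack γ yr ys P = γ * (P.map fun e => I.dist e.1 e.2).sum
      - (P.map fun e => yr e.1 + ys e.2).sum := by
    unfold Instance.slack
    rw [← List.sum_map_mul_left]
    generalize P = L
    induction L with
    | nil => simp
    | cons a L ih => simp only [List.map_cons, List.sum_cons, ih]; ring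
  unfold Instance.netCost
  rw [h2, h3]
  linarith

theorem slack_nonneg (hy : IsDual I γ M t yr ys) (P : AltPath m) : 0 ≤ I.slack γ yr ys P := by
  refine List.sum_nonneg ?_
  intro x hx
  obtain ⟨e, -, rfl⟩ := List.mem_map.1 hx
  linarith [hy.add_le e.1 e.2]

/-- Readiness says that the net-cost is at most γ times the waiting time, which is the dual of the
origin, while the terminus has dual 0. So the path has no slack and its forward edges are tight at γ
times their length. -/
theorem augment (hy : IsDual I γ M t yr ys) (hγ : 1 ≤ γ) {r : Fin m} {P : AltPath m}
    (hM : IsMatching M) (hP : I.IsReady γ M t r P) :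
    ∃ yr' ys', IsDual I γ (symmDiff M (AltPath.edges P)) t yr' ys' := by
  obtain ⟨s, h, hs, hr, -⟩ := Instance.isAugPath_iff.1 hP.1.1
  have hslack : I.slack γ yr ys P ≤ 0 := by
    have h1 := hy.netCost_eq h
    have h2 := hP.2
    rw [div_le_iff₀ (by linarith)] at h2
    rw [hy.req_free r h.origin_free, hy.srv_free s hs, max_eq_right (by linarith)] at h1
    linarith
  have htight : ∀ e ∈ P, yr e.1 + ys e.2 = γ * I.dist e.1 e.2 := by
    intro e he
    have : γ * I.dist e.1 e.2 - (yr e.1 + ys e.2) ≤ I.slack γ yr ys P := by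
      refine List.single_le_sum ?_ _ (List.mem_map_of_mem (f := fun e : Fin m × Fin m =>
        γ * I.dist e.1 e.2 - (yr e.1 + ys e.2)) he)
      intro x hx
      obtain ⟨e, -, rfl⟩ := List.mem_map.1 hx
      linarith [hy.add_le e.1 e.2]
    linarith [hy.add_le e.1 e.2]
  have hM' := h.isMatching_symmDiff hs hM
  set M' := symmDiff M (AltPath.edges P) with hM'def
  classical
  -- A matched edge must be tight at its length, not at γ times it. Only the request dual is lowered
  -- to achieve this, and it does go down because γ ≥ 1.
  let yr' : Fin m → ℝ := fun x =>
    if hx : ∃ e ∈ M', e.1 = x then I.dist hx.choose.1 hx.choose.2 - ys hx.choose.2 else yr x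
  have heq : ∀ e ∈ M', yr' e.1 = I.dist e.1 e.2 - ys e.2 := by
    intro e he
    have hx : ∃ f ∈ M', f.1 = e.1 := ⟨e, he, rfl⟩
    have : hx.choose = e := hM'.fst_inj _ hx.choose_spec.1 _ he hx.choose_spec.2
    simp only [yr', dif_pos hx, this]
  have hfree : ∀ x, (∀ e ∈ M', e.1 ≠ x) → yr' x = yr x := by
    intro x hx
    exact dif_neg (by push Not; exact hx)
  have hle : ∀ x, yr' x ≤ yr x := by
    intro x
    by_cases hx : ∃ e ∈ M', e.1 = x
    · obtain ⟨e, he, rfl⟩ := hx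
      rw [heq e he]
      rcases (h.mem_symmDiff e).1 he with he | he
      · have := htight e he
        nlinarith [I.dist_nonneg e.1 e.2]
      · linarith [hy.add_eq e he.1]
    · push Not at hx
      exact (hfree x hx).le
  refine ⟨yr', ys, ⟨?_, ?_, hy.srv_nonpos, ?_, ?_, ?_⟩⟩
  · intro x z; linarith [hle x, hy.add_le x z]
  · intro e he; linarith [heq e he]
  · intro z hz
    refine hy.srv_free z fun e he hez => ?_
    obtain ⟨f, hf, hfz⟩ := (h.saturates_server_iff z).2 (Or.inr ⟨e, he, hez⟩)
    exact hz f hf hfz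
  · intro x hx
    rw [hfree x hx]
    refine hy.req_free x fun e he hex => ?_
    obtain ⟨f, hf, hfx⟩ := (h.saturates_request_iff x).2 (Or.inr ⟨e, he, hex⟩)
    exact hx f hf hfx
  · intro x; exact (hle x).trans (hy.req_le x)

/-- The continuous growth of the duals is done in one jump, with shortest-path potentials in the
slack metric: `g` is the increase forced on free requests, and `u s` is the part of it that survives
the slack on the best alternating path to `s`. Server `s` loses `u s` and its matched request gains
it. -/
theorem grow (hy : IsDual I γ M t yr ys) (hγ : 0 < γ) {t' : ℝ} (htt' : t ≤ t')
    (hM : IsMatching M) (harr : ∀ e ∈ M, I.reqTime e.1 ≤ t ∧ I.srvTime e.2 ≤ t)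
    (hready : ∀ t'', t ≤ t'' → t'' < t' → ∀ r P, ¬ I.IsReady γ M t'' r P) :
    ∃ yr' ys', IsDual I γ M t' yr' ys' := by
  rcases htt'.eq_or_lt with rfl | hlt
  · exact ⟨yr, ys, hy⟩
  let g : Fin m → ℝ := fun r => γ * max 0 (t' - I.reqTime r) - γ * max 0 (t - I.reqTime r)
  have hg0 : ∀ r, 0 ≤ g r := fun r =>
    sub_nonneg.2 (mul_le_mul_of_nonneg_left (max_le_max le_rfl (by linarith)) hγ.le)
  have hg1 : ∀ r, g r ≤ γ * (t' - t) := by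
    intro r
    have : max 0 (t' - I.reqTime r) ≤ max 0 (t - I.reqTime r) + (t' - t) :=
      max_le (by linarith [le_max_left 0 (t - I.reqTime r)])
        (by linarith [le_max_right 0 (t - I.reqTime r)])
    have := mul_le_mul_of_nonneg_left this hγ.le
    simp only [g]
    linarith
  -- Only paths through servers that arrive before `t'` count; later servers need no adjustment. The
  -- value 0 is included so that server duals never increase.
  obtain ⟨u, hu0, hu1, hu2⟩ : ∃ u : Fin m → ℝ, (∀ s, 0 ≤ u s) ∧
      (∀ r s P, IsAlternating M r s P → (∀ e ∈ P, I.srvTime e.2 < t') →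
        g r - I.slack γ yr ys P ≤ u s) ∧
      (∀ s, u s = 0 ∨ ∃ r P, IsAlternating M r s P ∧ (∀ e ∈ P, I.srvTime e.2 < t') ∧
        u s = g r - I.slack γ yr ys P) := by
    have : ∀ s, ∃ x : ℝ, 0 ≤ x ∧ (∀ r P, IsAlternating M r s P → (∀ e ∈ P, I.srvTime e.2 < t') →
        g r - I.slack γ yr ys P ≤ x) ∧
        (x = 0 ∨ ∃ r P, IsAlternating M r s P ∧ (∀ e ∈ P, I.srvTime e.2 < t') ∧
        x = g r - I.slack γ yr ys P) := by
      intro s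
      let V : Set ℝ := insert 0 {x | ∃ r P, IsAlternating M r s P ∧
        (∀ e ∈ P, I.srvTime e.2 < t') ∧ x = g r - I.slack γ yr ys P}
      have hV : V.Finite := by
        refine Set.Finite.insert _ ?_
        refine ((Set.finite_univ.prod (finite_isAlternating M)).image
          fun p : Fin m × AltPath m => g p.1 - I.slack γ yr ys p.2).subset ?_
        rintro x ⟨r, P, hP, -, rfl⟩
        exact ⟨(r, P), ⟨Set.mem_univ _, r, s, hP⟩, rfl⟩
      obtain ⟨x, hx, hmax⟩ := Set.exists_max_image V id hV ⟨0, Set.mem_insert _ _⟩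
      refine ⟨x, hmax 0 (Set.mem_insert _ _), ?_, ?_⟩
      · intro r P h1 h2
        exact hmax _ (Set.mem_insert_of_mem _ ⟨r, P, h1, h2, rfl⟩)
      · rcases hx with hx | hx
        · exact Or.inl hx
        · exact Or.inr hx
    choose u h1 h2 h3 using this
    exact ⟨u, h1, fun r s P => h2 s r P, h3⟩
  -- one more edge cannot improve on `u`
  have hstep_free : ∀ r s, (∀ e ∈ M, e.1 ≠ r) → I.srvTime s < t' →
      g r - (γ * I.dist r s - (yr r + ys s)) ≤ u s := by
    intro r s hr hs
    have := hu1 r s [(r, s)] ⟨rfl, rfl, hr, by simp, by simp,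
      by simp only [List.mem_singleton, forall_eq]; exact fun h => hr _ h rfl,
      by simp [AltPath.backEdges]⟩ (by simpa using hs)
    simpa [Instance.slack] using this
  have hstep_sat : ∀ e ∈ M, ∀ s, I.srvTime s < t' →
      u e.2 - (γ * I.dist e.1 s - (yr e.1 + ys s)) ≤ u s := by
    intro e he s hs
    have hsl := hy.add_le e.1 s
    rcases hu2 e.2 with h0 | ⟨r0, P, hP, hPt, hval⟩
    · rw [h0]; linarith [hu0 s]
    -- If `s` is already on the path, the prefix ending at `s` has no larger slack and serves
    -- instead, so paths can be kept simple.
    by_cases hsP : s ∈ P.map Prod.snd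
    · obtain ⟨f, hf, rfl⟩ := List.mem_map.1 hsP
      obtain ⟨P1, P2, rfl⟩ := List.append_of_mem hf
      have hcat : P1 ++ f :: P2 = (P1 ++ [f]) ++ P2 := by simp
      rw [hcat] at hP hPt hval
      have halt : IsAlternating M r0 f.2 (P1 ++ [f]) := by
        refine ⟨?_, by simp [AltPath.terminus?], hP.origin_free, ?_, ?_, ?_, ?_⟩
        · have := hP.origin_eq
          cases P1 <;> simpa [AltPath.origin?] using this
        · have := hP.nodup_requests
          rw [List.map_append] at this
          exact this.of_append_left
        · have := hP.nodup_servers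
          rw [List.map_append] at this
          exact this.of_append_left
        · exact fun e he => hP.notMem e (List.mem_append_left _ he)
        · exact fun e he => hP.mem e (AltPath.mem_backEdges_append _ _ e he)
      have h1 := hu1 _ _ _ halt fun e he => hPt e (List.mem_append_left _ he)
      have h2 := hy.slack_nonneg P2
      have h3 : I.slack γ yr ys (P1 ++ [f] ++ P2)
          = I.slack γ yr ys (P1 ++ [f]) + I.slack γ yr ys P2 := by
        simp only [Instance.slack, List.map_append, List.sum_append]
      linarith
    · have hreq : e.1 ∉ P.map Prod.fst := by
        intro hmem
        obtain ⟨f, hf, hfe⟩ := List.mem_map.1 hmem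
        rcases AltPath.origin?_or_backEdges P f hf with h' | ⟨b, hb, hbf⟩
        · rw [hP.origin_eq, Option.some_inj] at h'
          exact hP.origin_free e he (by rw [h', hfe])
        · have hbe : b = e := hM.fst_inj b (hP.mem b hb) e he (hbf.trans hfe)
          subst hbe
          -- the terminus would be the server of a back edge
          obtain ⟨L, hL⟩ : ∃ L, P.map Prod.snd = L ++ [b.2] := by
            have := hP.terminus_eq
            obtain ⟨l, hl, hl2⟩ := Option.map_eq_some_iff.1 this
            obtain ⟨Q, hQ⟩ := List.getLast?_eq_some_iff.1 hl
            exact ⟨Q.map Prod.snd, by rw [hQ]; simp [hl2]⟩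
          have hmem' : b.2 ∈ L := by
            have : AltPath.backEdges P = List.zip (P.tail.map Prod.fst) L := by
              unfold AltPath.backEdges
              rw [hL]
              have h4 := List.zip_append (l₁ := P.tail.map Prod.fst) (r₁ := ([] : List (Fin m)))
                (l₂ := L) (r₂ := [b.2]) (by
                  have := congrArg List.length hL
                  simp at this ⊢
                  omega)
              simpa using h4
            rw [this] at hb
            exact (List.of_mem_zip (a := b.1) (b := b.2) hb).2
          have := hP.nodup_servers
          rw [hL, List.nodup_append] at this
          exact this.2.2 _ hmem' _ (List.mem_singleton_self _) rfl
      have halt : IsAlternating M r0 s (P ++ [(e.1, s)]) := by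
        refine ⟨?_, by simp [AltPath.terminus?], hP.origin_free, ?_, ?_, ?_, ?_⟩
        · have := hP.origin_eq
          cases P with
          | nil => simp [AltPath.origin?] at this
          | cons a P => simpa [AltPath.origin?] using this
        · rw [List.map_append, List.nodup_append]
          refine ⟨hP.nodup_requests, by simp, ?_⟩
          intro a ha b hb hab
          simp at hb
          subst hb hab
          exact hreq ha
        · rw [List.map_append, List.nodup_append]
          refine ⟨hP.nodup_servers, by simp, ?_⟩
          intro a ha b hb hab
          simp at hb
          subst hb hab
          exact hsP ha
        · intro f hf hfM
          rcases List.mem_append.1 hf with hf | hf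
          · exact hP.notMem f hf hfM
          · rw [List.mem_singleton] at hf
            subst hf
            have := hM.fst_inj _ hfM _ he rfl
            obtain ⟨x, hx, hx2⟩ := AltPath.exists_mem_terminus hP.terminus_eq
            rw [← this] at hx2
            exact hsP (List.mem_map.2 ⟨x, hx, hx2⟩)
        · intro f hf
          rcases AltPath.mem_backEdges_concat P _ f hf with hf | ⟨z, hz, rfl⟩
          · exact hP.mem f hf
          · rw [hP.terminus_eq, Option.some_inj] at hz
            rw [← hz]
            exact he
      have h1 := hu1 _ _ _ halt (by
        intro f hf
        rcases List.mem_append.1 hf with hf | hf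
        · exact hPt f hf
        · rw [List.mem_singleton] at hf
          rw [hf]; exact hs)
      have h3 : I.slack γ yr ys (P ++ [(e.1, s)])
          = I.slack γ yr ys P + (γ * I.dist e.1 s - (yr e.1 + ys s)) := by
        simp [Instance.slack, List.map_append, List.sum_append]
      linarith
  -- A positive `u s` at a free server would mean an augmenting path whose net-cost is below γ times
  -- the waiting time at `t'`; its request would have been ready strictly before `t'`.
  have hu_free : ∀ s, (∀ e ∈ M, e.2 ≠ s) → u s = 0 := by
    intro s hs
    rcases hu2 s with h0 | ⟨r, P, hP, hPt, hval⟩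
    · exact h0
    by_contra hne
    have hpos : 0 < u s := lt_of_le_of_ne (hu0 s) (Ne.symm hne)
    have hst : I.srvTime s < t' := by
      obtain ⟨e, he, rfl⟩ := AltPath.exists_mem_terminus hP.terminus_eq
      exact hPt e he
    have hnc := hy.netCost_eq hP
    rw [hy.srv_free s hs, hy.req_free r hP.origin_free] at hnc
    have hnc' : I.netCost γ P < γ * max 0 (t' - I.reqTime r) := by
      simp only [g] at hval
      linarith
    have hnc0 : 0 ≤ I.netCost γ P := by
      have := hy.slack_nonneg P
      have := mul_nonneg hγ.le (le_max_left 0 (t - I.reqTime r))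
      linarith
    have hrt : I.reqTime r < t' := by
      by_contra hc
      rw [max_eq_left (by linarith)] at hnc'
      linarith
    rw [max_eq_right (by linarith)] at hnc'
    have hd : I.netCost γ P / γ < t' - I.reqTime r := by
      rw [div_lt_iff₀ hγ]; linarith
    -- The first moment from `t` on at which the server has arrived and the waiting time covers the
    -- net-cost.
    set t'' := max (max t (I.srvTime s)) (I.reqTime r + I.netCost γ P / γ) with ht''
    have h1 : t ≤ t'' := (le_max_left _ _).trans (le_max_left _ _)
    have h2 : I.srvTime s ≤ t'' := (le_max_right _ _).trans (le_max_left _ _)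
    have h3 : I.reqTime r + I.netCost γ P / γ ≤ t'' := le_max_right _ _
    have h4 : t'' < t' := max_lt (max_lt hlt hst) (by linarith)
    have h5 : 0 ≤ I.netCost γ P / γ := div_nonneg hnc0 hγ.le
    obtain ⟨Q, hQ⟩ := Instance.exists_isReady hγ
      (Instance.isAugPath_iff.2 ⟨s, hP, hs, by linarith, h2⟩)
      (by
        have : I.netCost γ P / γ ≤ t'' - I.reqTime r := by linarith
        rw [div_le_iff₀ hγ] at this
        linarith)
    exact hready t'' h1 h4 r Q hQ
  have hu_le : ∀ s, u s ≤ γ * (t' - t) := by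
    intro s
    rcases hu2 s with h0 | ⟨r, P, -, -, hval⟩
    · rw [h0]; exact mul_nonneg hγ.le (by linarith)
    · rw [hval]; linarith [hg1 r, hy.slack_nonneg P]
  classical
  let Δ : Fin m → ℝ := fun x => if hx : ∃ e ∈ M, e.1 = x then u hx.choose.2 else g x
  have hΔ_sat : ∀ e ∈ M, Δ e.1 = u e.2 := by
    intro e he
    have hx : ∃ f ∈ M, f.1 = e.1 := ⟨e, he, rfl⟩
    have : hx.choose = e := hM.fst_inj _ hx.choose_spec.1 _ he hx.choose_spec.2
    simp only [Δ, dif_pos hx, this]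
  have hΔ_free : ∀ x, (∀ e ∈ M, e.1 ≠ x) → Δ x = g x := fun x hx =>
    dif_neg (by push Not; exact hx)
  have hΔ : ∀ r s, I.srvTime s < t' → Δ r - (γ * I.dist r s - (yr r + ys s)) ≤ u s := by
    intro r s hs
    by_cases hx : ∃ e ∈ M, e.1 = r
    · obtain ⟨e, he, rfl⟩ := hx
      rw [hΔ_sat e he]
      exact hstep_sat e he s hs
    · push Not at hx
      rw [hΔ_free r hx]
      exact hstep_free r s hx hs
  have hle : ∀ r, yr r + Δ r ≤ γ * max 0 (t' - I.reqTime r) := by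
    intro r
    by_cases hx : ∃ e ∈ M, e.1 = r
    · obtain ⟨e, he, rfl⟩ := hx
      have h1 := hy.req_le e.1
      have h2 := (harr e he).1
      rw [max_eq_right (by linarith)] at h1 ⊢
      rw [hΔ_sat e he]
      linarith [hu_le e.2]
    · push Not at hx
      rw [hΔ_free r hx]
      have := hy.req_le r
      simp only [g]
      linarith
  refine ⟨fun r => yr r + Δ r, fun s => ys s - u s, ⟨?_, ?_, ?_, ?_, ?_, hle⟩⟩
  · intro r s
    by_cases hs : I.srvTime s < t'
    · have := hΔ r s hs
      linarith
    -- For a server arriving at `t'` or later, the difference of arrival times alone bounds the dual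
    -- of the request.
    · push Not at hs
      have h1 := hle r
      have h2 := hy.srv_nonpos s
      have h3 := hu0 s
      have h4 : max 0 (t' - I.reqTime r) ≤ I.dist r s := by
        refine max_le (I.dist_nonneg r s) ?_
        unfold Instance.dist
        have := neg_abs_le (I.reqTime r - I.srvTime s)
        have := abs_nonneg (I.reqPos r - I.srvPos s)
        linarith
      have := mul_le_mul_of_nonneg_left h4 hγ.le
      linarith
  · intro e he
    have := hy.add_eq e he
    rw [hΔ_sat e he]
    linarith
  · intro s
    linarith [hy.srv_nonpos s, hu0 s]
  · intro s hs
    rw [hy.srv_free s hs, hu_free s hs, sub_zero]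
  · intro r hr
    rw [hΔ_free r hr, hy.req_free r hr]
    simp only [g]
    ring

end IsDual

/-! ### Alternating paths between the offline matching and a reference matching. -/

/-- The requests `x 0 = q, x 1, …, x l` visited by the path from `q` that alternates between edges
`(r, σ r)` and edges of `M`, up to a server that is not saturated by `M`. -/
structure IsOrbit (M : Finset (Fin m × Fin m)) (σ : Equiv.Perm (Fin m)) (q : Fin m) (l : ℕ)
    (x : ℕ → Fin m) : Prop where
  zero : x 0 = q
  succ : ∀ n < l, (x (n + 1), σ (x n)) ∈ M
  last : ∀ e ∈ M, e.2 ≠ σ (x l)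

/-- Each vertex determines its predecessor, as `M` is a matching and `σ` is injective. Tracing two
coinciding vertices back must reach the starts simultaneously, because a start is not saturated.
This gives both simplicity of one path and disjointness of two. -/
theorem orbit_injective {M : Finset (Fin m × Fin m)} (hM : IsMatching M) {σ : Equiv.Perm (Fin m)}
    {q q' : Fin m} {l l' : ℕ} {x x' : ℕ → Fin m} (hq : ∀ e ∈ M, e.1 ≠ q) (hq' : ∀ e ∈ M, e.1 ≠ q')
    (h0 : x 0 = q) (h0' : x' 0 = q') (hs : ∀ n < l, (x (n + 1), σ (x n)) ∈ M)
    (hs' : ∀ n < l', (x' (n + 1), σ (x' n)) ∈ M) :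
    ∀ i j, i ≤ l → j ≤ l' → x i = x' j → q = q' ∧ i = j := by
  intro i
  induction i with
  | zero =>
    intro j _ hj h
    cases j with
    | zero => exact ⟨by rw [← h0, ← h0', h], rfl⟩
    | succ j => exact absurd (h.symm.trans h0) (hq _ (hs' j hj))
  | succ i ih =>
    intro j hi hj h
    cases j with
    | zero => exact absurd (h.trans h0') (hq' _ (hs i hi))
    | succ j =>
      have h1 := hM.fst_inj _ (hs i hi) _ (hs' j hj) h
      have h2 : x i = x' j := σ.injective (congrArg Prod.snd h1)
      obtain ⟨h3, h4⟩ := ih j (by omega) (by omega) h2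
      exact ⟨h3, by rw [h4]⟩

/-- An orbit that never met an unsaturated server would be an injection of ℕ into a finite set. -/
theorem exists_isOrbit {M : Finset (Fin m × Fin m)} (hM : IsMatching M) (σ : Equiv.Perm (Fin m))
    {q : Fin m} (hq : ∀ e ∈ M, e.1 ≠ q) : ∃ l x, IsOrbit M σ q l x := by
  classical
  let nxt : Fin m → Fin m := fun r => if h : ∃ e ∈ M, e.2 = σ r then h.choose.1 else r
  let x : ℕ → Fin m := fun n => nxt^[n] q
  have hx : ∀ n, (∃ e ∈ M, e.2 = σ (x n)) → (x (n + 1), σ (x n)) ∈ M := by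
    intro n h
    have h1 : x (n + 1) = h.choose.1 := by
      simp only [x, Function.iterate_succ_apply']
      exact dif_pos h
    have h2 := h.choose_spec
    have h3 : (x (n + 1), σ (x n)) = h.choose := Prod.ext h1 h2.2.symm
    rw [h3]
    exact h2.1
  have hex : ∃ n, ¬ ∃ e ∈ M, e.2 = σ (x n) := by
    by_contra hc
    push Not at hc
    have hs : ∀ n, (x (n + 1), σ (x n)) ∈ M := fun n => hx n (hc n)
    have hinj : Function.Injective x := fun i j hij =>
      (orbit_injective hM hq hq rfl rfl (l := i) (l' := j) (fun n _ => hs n) (fun n _ => hs n)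
        i j le_rfl le_rfl hij).2
    exact not_injective_infinite_finite x hinj
  refine ⟨Nat.find hex, x, rfl, ?_, ?_⟩
  · intro n hn
    exact hx n (not_not.1 (Nat.find_min hex hn))
  · exact fun e he h => Nat.find_spec hex ⟨e, he, h⟩

/-- The alternating paths between `M` and the perfect matching `σ` that start at the requests not
saturated by `M`: each is given by its requests, and its weight in `σ` controls its extent and the
duals of the nearby requests that are not saturated. -/
theorem IsDual.exists_alternating_sets {I : Instance m} {γ t : ℝ} {M : Finset (Fin m × Fin m)}
    {yr ys : Fin m → ℝ} (hy : IsDual I γ M t yr ys) (hγ : 0 ≤ γ) (hM : IsMatching M)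
    (σ : Equiv.Perm (Fin m)) :
    ∃ E : Fin m → Finset (Fin m),
      (∀ q q', (∀ e ∈ M, e.1 ≠ q) → (∀ e ∈ M, e.1 ≠ q') → q ≠ q' → Disjoint (E q) (E q')) ∧
      ∀ q, (∀ e ∈ M, e.1 ≠ q) →
        (∀ x ∈ E q, I.reqDist q x ≤ (1 + γ) * ∑ z ∈ E q, I.dist z (σ z)) ∧
        ∀ r, (∀ e ∈ M, e.1 ≠ r) →
          yr r ≤ γ * (∑ z ∈ E q, I.dist z (σ z) + I.reqDist q r) := by
  classical
  have hex : ∀ q, ∃ l x, (∀ e ∈ M, e.1 ≠ q) → IsOrbit M σ q l x := by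
    intro q
    by_cases hq : ∀ e ∈ M, e.1 ≠ q
    · obtain ⟨l, x, h⟩ := exists_isOrbit hM σ hq
      exact ⟨l, x, fun _ => h⟩
    · exact ⟨0, fun _ => q, fun h => absurd h hq⟩
  choose l x horb using hex
  refine ⟨fun q => (Finset.range (l q + 1)).image (x q), ?_, ?_⟩
  · intro q q' hq hq' hne
    rw [Finset.disjoint_left]
    intro a ha ha'
    obtain ⟨i, hi, rfl⟩ := Finset.mem_image.1 ha
    obtain ⟨j, hj, hij⟩ := Finset.mem_image.1 ha'
    rw [Finset.mem_range] at hi hj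
    exact hne (orbit_injective hM hq hq' (horb q hq).zero (horb q' hq').zero (horb q hq).succ
      (horb q' hq').succ i j (by omega) (by omega) hij.symm).1
  · intro q hq
    obtain ⟨hz, hs, hl⟩ := horb q hq
    have hsum : ∑ z ∈ (Finset.range (l q + 1)).image (x q), I.dist z (σ z)
        = ∑ n ∈ Finset.range (l q + 1), I.dist (x q n) (σ (x q n)) := by
      refine Finset.sum_image ?_
      intro i hi j hj hij
      simp only [Finset.coe_range, Set.mem_Iio] at hi hj
      exact (orbit_injective hM hq hq hz hz hs hs i j (by omega) (by omega) hij).2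
    rw [hsum]
    -- Potential telescoping: a `σ`-edge costs at most γ times its length, and a matched edge is
    -- refunded exactly its length. The start value `z` is left free, because the dual of `q` itself
    -- is not the one needed.
    have hpot : ∀ z : ℝ, z + ys (σ q) ≤ γ * I.dist q (σ q) → ∀ N ≤ l q,
        z + ys (σ (x q N)) ≤ γ * ∑ n ∈ Finset.range (N + 1), I.dist (x q n) (σ (x q n))
          - ∑ n ∈ Finset.range N, I.dist (x q (n + 1)) (σ (x q n)) := by
      intro z h N
      induction N with
      | zero => intro _; simpa [hz] using h
      | succ N ih =>
        intro hN
        have h1 := ih (by omega)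
        have h2 := hy.add_eq _ (hs N hN)
        have h3 := hy.add_le (x q (N + 1)) (σ (x q (N + 1)))
        rw [Finset.sum_range_succ (fun n => I.dist (x q n) (σ (x q n))) (N + 1),
          Finset.sum_range_succ (fun n => I.dist (x q (n + 1)) (σ (x q n))) N, mul_add]
        dsimp only at h2
        linarith
    have hlast := hy.srv_free _ hl
    have hB : 0 ≤ ∑ n ∈ Finset.range (l q), I.dist (x q (n + 1)) (σ (x q n)) :=
      Finset.sum_nonneg fun n _ => I.dist_nonneg _ _
    constructor
    -- With `z = 0` the matched edges have total length at most γ times that of the `σ`-edges,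
    -- whence the factor 1 + γ for the extent.
    · have hBA := hpot 0 (by
        have := hy.srv_nonpos (σ q)
        have := mul_nonneg hγ (I.dist_nonneg q (σ q))
        linarith) (l q) le_rfl
      rw [hlast] at hBA
      have hd : ∀ n, I.reqDist q (x q n)
          ≤ ∑ i ∈ Finset.range n, (I.dist (x q i) (σ (x q i)) + I.dist (x q (i + 1)) (σ (x q i))) := by
        intro n
        induction n with
        | zero => simp [hz, Instance.reqDist]
        | succ n ih =>
          rw [Finset.sum_range_succ]
          have h1 := I.reqDist_triangle q (x q n) (x q (n + 1))
          have h2 := I.reqDist_le (x q n) (x q (n + 1)) (σ (x q n))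
          linarith
      intro a ha
      obtain ⟨n, hn, rfl⟩ := Finset.mem_image.1 ha
      rw [Finset.mem_range] at hn
      have h1 := hd n
      have h2 : ∑ i ∈ Finset.range n,
          (I.dist (x q i) (σ (x q i)) + I.dist (x q (i + 1)) (σ (x q i)))
          ≤ ∑ i ∈ Finset.range (l q),
          (I.dist (x q i) (σ (x q i)) + I.dist (x q (i + 1)) (σ (x q i))) :=
        Finset.sum_le_sum_of_subset_of_nonneg (Finset.range_mono (by omega))
          fun i _ _ => add_nonneg (I.dist_nonneg _ _) (I.dist_nonneg _ _)
      simp only [Finset.sum_add_distrib] at h1 h2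
      have h3 := Finset.sum_range_succ (fun n => I.dist (x q n) (σ (x q n))) (l q)
      have h4 := I.dist_nonneg (x q (l q)) (σ (x q (l q)))
      linarith
    · intro r hr
      -- The dual of another free request `r` is carried over to `q` at a loss of γ times their
      -- distance. This works even if `q` has waited less than `r` or has not yet arrived.
      have := hpot (yr r - γ * I.reqDist q r) (by
        have h1 := hy.add_le r (σ q)
        have h2 := I.dist_le_reqDist_add r q (σ q)
        have h3 : I.reqDist r q = I.reqDist q r := by
          unfold Instance.reqDist
          rw [abs_sub_comm, abs_sub_comm (I.reqTime r)]
        rw [h3] at h2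
        have := mul_le_mul_of_nonneg_left h2 hγ
        linarith) (l q) le_rfl
      rw [hlast] at this
      linarith

/-! ### Dyadic grids and the packing bound. -/

theorem exists_dyadic_level (J : ℕ) {x : ℝ} (h1 : x ≤ 1) (h2 : (1 / 2 : ℝ) ^ J < x) :
    ∃ j < J, (1 / 2 : ℝ) ^ (j + 1) < x ∧ x ≤ (1 / 2) ^ j := by
  induction J with
  | zero => simp at h2; linarith
  | succ J ih =>
    by_cases h : (1 / 2 : ℝ) ^ J < x
    · obtain ⟨j, hj, h'⟩ := ih h
      exact ⟨j, by omega, h'⟩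
    · exact ⟨J, by omega, h2, not_lt.1 h⟩

/-- The cell containing a point in the square grid of side `2⁻ⁱ`. -/
noncomputable def gridCell {α : Type*} (px py : α → ℝ) (i : ℕ) (x : α) : ℤ × ℤ :=
  (⌊px x * 2 ^ i⌋, ⌊py x * 2 ^ i⌋)

theorem abs_sub_le_of_floor_eq {a b : ℝ} {i : ℕ} (h : ⌊a * 2 ^ i⌋ = ⌊b * 2 ^ i⌋) :
    |a - b| ≤ (1 / 2) ^ i := by
  have h1 := Int.abs_sub_lt_one_of_floor_eq_floor h
  rw [← sub_mul, abs_mul, abs_of_pos (by positivity : (0 : ℝ) < 2 ^ i)] at h1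
  rw [one_div, inv_pow, ← one_div, le_div_iff₀ (by positivity)]
  exact h1.le

theorem floor_mem_Icc {a b : ℝ} {i : ℕ} (h : |a - b| ≤ 4 * (1 / 2) ^ i) :
    ⌊a * 2 ^ i⌋ ∈ Finset.Icc (⌊b * 2 ^ i⌋ - 4) (⌊b * 2 ^ i⌋ + 4) := by
  have hp : (0 : ℝ) < 2 ^ i := by positivity
  have h1 : |a * 2 ^ i - b * 2 ^ i| ≤ 4 := by
    rw [← sub_mul, abs_mul, abs_of_pos hp]
    calc |a - b| * 2 ^ i ≤ 4 * (1 / 2) ^ i * 2 ^ i := mul_le_mul_of_nonneg_right h hp.le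
      _ = 4 := by rw [mul_assoc, ← mul_pow]; norm_num
  obtain ⟨h2, h3⟩ := abs_le.1 h1
  rw [Finset.mem_Icc]
  constructor
  · rw [Int.le_floor]
    push_cast
    linarith [Int.floor_le (b * 2 ^ i)]
  · rw [← Int.lt_add_one_iff, Int.floor_lt]
    push_cast
    linarith [Int.lt_floor_add_one (b * 2 ^ i)]

theorem floor_mem_Ico {a : ℝ} {i n : ℕ} :
    ⌊a * 2 ^ (n + i)⌋ ∈ Finset.Ico (⌊a * 2 ^ i⌋ * 2 ^ n) ((⌊a * 2 ^ i⌋ + 1) * 2 ^ n) := by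
  have h1 := Int.floor_le (a * 2 ^ i)
  have h2 := Int.lt_floor_add_one (a * 2 ^ i)
  have hp : (0 : ℝ) < 2 ^ n := by positivity
  have he : a * 2 ^ (n + i) = a * 2 ^ i * 2 ^ n := by rw [pow_add]; ring
  rw [Finset.mem_Ico, Int.le_floor, Int.floor_lt, he]
  push_cast
  exact ⟨mul_le_mul_of_nonneg_right h1 hp.le, mul_lt_mul_of_pos_right h2 hp⟩

theorem card_gridCell_image_le {α : Type*} (px py : α → ℝ) (i n : ℕ) (T : Finset α) (g : ℤ × ℤ)
    (hT : ∀ k ∈ T, gridCell px py i k = g) :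
    (T.image (gridCell px py (n + i))).card ≤ (2 ^ n) ^ 2 := by
  have hsub : T.image (gridCell px py (n + i)) ⊆
      Finset.Ico (g.1 * 2 ^ n) ((g.1 + 1) * 2 ^ n) ×ˢ Finset.Ico (g.2 * 2 ^ n) ((g.2 + 1) * 2 ^ n) := by
    intro h hh
    obtain ⟨k, hk, rfl⟩ := Finset.mem_image.1 hh
    have := hT k hk
    subst this
    exact Finset.mem_product.2 ⟨floor_mem_Ico, floor_mem_Ico⟩
  refine (Finset.card_le_card hsub).trans ?_
  rw [Finset.card_product, Int.card_Ico, Int.card_Ico]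
  have : ∀ z : ℤ, ((z + 1) * 2 ^ n - z * 2 ^ n).toNat = 2 ^ n := by
    intro z
    have : (z + 1) * 2 ^ n - z * 2 ^ n = ((2 ^ n : ℕ) : ℤ) := by push_cast; ring
    rw [this, Int.toNat_natCast]
  rw [this, this, sq]

/-- The weight `o` of the grid cells of side `2⁻ⁱ` near the cell `g`. -/
noncomputable def nearWeight {α : Type*} [Fintype α] (px py o : α → ℝ) (i : ℕ) (g : ℤ × ℤ) : ℝ :=
  ∑ x with g ∈ Finset.Icc (⌊px x * 2 ^ i⌋ - 4) (⌊px x * 2 ^ i⌋ + 4) ×ˢ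
    Finset.Icc (⌊py x * 2 ^ i⌋ - 4) (⌊py x * 2 ^ i⌋ + 4), o x

/-- Each point is near at most 9 · 9 = 81 cells. -/
theorem sum_nearWeight_le {α : Type*} [Fintype α] (px py o : α → ℝ) (ho : ∀ x, 0 ≤ o x) (i : ℕ)
    (G : Finset (ℤ × ℤ)) : ∑ g ∈ G, nearWeight px py o i g ≤ 81 * ∑ x, o x := by
  unfold nearWeight
  simp_rw [Finset.sum_filter]
  rw [Finset.sum_comm, Finset.mul_sum]
  refine Finset.sum_le_sum fun x _ => ?_
  rw [← Finset.sum_filter, Finset.sum_const, nsmul_eq_mul]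
  refine mul_le_mul_of_nonneg_right ?_ (ho x)
  have : (G.filter fun g => g ∈ Finset.Icc (⌊px x * 2 ^ i⌋ - 4) (⌊px x * 2 ^ i⌋ + 4) ×ˢ
      Finset.Icc (⌊py x * 2 ^ i⌋ - 4) (⌊py x * 2 ^ i⌋ + 4)).card ≤ 81 := by
    refine (Finset.card_le_card (t := Finset.Icc (⌊px x * 2 ^ i⌋ - 4) (⌊px x * 2 ^ i⌋ + 4) ×ˢ
      Finset.Icc (⌊py x * 2 ^ i⌋ - 4) (⌊py x * 2 ^ i⌋ + 4))
      fun g hg => (Finset.mem_filter.1 hg).2).trans ?_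
    rw [Finset.card_product, Int.card_Icc, Int.card_Icc]
    have : ∀ z : ℤ, (z + 4 + 1 - (z - 4)).toNat = 9 := by intro z; omega
    rw [this, this]
  exact_mod_cast this

/-- A set of points, each with a set of weight about `2⁻ⁱ` nearby, these sets being disjoint for
points in the same cell of side `2⁻ʲ / 16`, has at most about `2ʲ √n` elements. -/
theorem card_le_of_disjoint_nearby {α : Type*} [Fintype α] (px py o : α → ℝ) (ho : ∀ x, 0 ≤ o x)
    (hsum : ∑ x, o x ≤ 1) {i j : ℕ} (hij : i ≤ j + 4) (T : Finset α) (F : α → Finset α)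
    (hlow : ∀ k ∈ T, (1 / 2 : ℝ) ^ (i + 1) ≤ ∑ x ∈ F k, o x)
    (hx : ∀ k ∈ T, ∀ x ∈ F k, |px k - px x| ≤ 4 * (1 / 2) ^ i)
    (hy : ∀ k ∈ T, ∀ x ∈ F k, |py k - py x| ≤ 4 * (1 / 2) ^ i)
    (hdisj : ∀ k ∈ T, ∀ k' ∈ T, gridCell px py (j + 4) k = gridCell px py (j + 4) k' → k ≠ k' →
      Disjoint (F k) (F k')) :
    (1 / 2 : ℝ) ^ j * T.card ≤ 2592 * √(Fintype.card α) := by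
  classical
  set ρ : ℝ := (1 / 2) ^ i with hρ
  have hρ0 : 0 < ρ := by positivity
  have hρ1 : (1 / 2 : ℝ) ^ (i + 1) = ρ / 2 := by rw [pow_succ]; ring
  rw [hρ1] at hlow
  set δ : ℝ := (1 / 2) ^ j with hδ
  have hδ0 : 0 < δ := by positivity
  obtain ⟨n, hn⟩ : ∃ n, j + 4 = n + i := ⟨j + 4 - i, by omega⟩
  -- A coarse cell of side ρ is cut into `2 ^ n` by `2 ^ n` fine cells of side δ/16.
  have hδρ : δ * 2 ^ n = 16 * ρ := by
    have h1 : (2 : ℝ) ^ j * 2 ^ 4 = 2 ^ n * 2 ^ i := by rw [← pow_add, ← pow_add, hn]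
    have h2 : δ * 2 ^ j = 1 := by rw [hδ, ← mul_pow]; norm_num
    have h3 : ρ * 2 ^ i = 1 := by rw [hρ, ← mul_pow]; norm_num
    calc δ * 2 ^ n = δ * (2 ^ n * (ρ * 2 ^ i)) := by rw [h3, mul_one]
      _ = δ * ρ * (2 ^ n * 2 ^ i) := by ring
      _ = ρ * 16 * (δ * 2 ^ j) := by rw [← h1]; ring
      _ = 16 * ρ := by rw [h2]; ring
  have hcell : ∀ g, δ * (T.filter fun k => gridCell px py i k = g).card
      ≤ 32 * √(Fintype.card α) * nearWeight px py o i g := by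
    intro g
    set Tg := T.filter fun k => gridCell px py i k = g with hTg
    set V := nearWeight px py o i g with hV
    have hV0 : 0 ≤ V := Finset.sum_nonneg fun x _ => ho x
    rcases Tg.eq_empty_or_nonempty with he | ⟨k0, hk0⟩
    · rw [he]
      simp only [Finset.card_empty, Nat.cast_zero, mul_zero]
      positivity
    -- Disjoint sets of weight at least ρ/2 within distance 4ρ of the cell all fit into the nearby
    -- weight `V`.
    have hcl : ∀ S ⊆ Tg, (∀ k ∈ S, ∀ k' ∈ S, k ≠ k' → Disjoint (F k) (F k')) →
        (S.card : ℝ) * (ρ / 2) ≤ V := by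
      intro S hS hSd
      have h1 : (S.card : ℝ) * (ρ / 2) ≤ ∑ k ∈ S, ∑ x ∈ F k, o x := by
        rw [← nsmul_eq_mul]
        exact Finset.card_nsmul_le_sum _ _ _ fun k hk => hlow k (Finset.mem_filter.1 (hS hk)).1
      rw [← Finset.sum_biUnion fun k hk k' hk' hne => hSd k hk k' hk' hne] at h1
      refine h1.trans (Finset.sum_le_sum_of_subset_of_nonneg ?_ fun x _ _ => ho x)
      intro x hxS
      obtain ⟨k, hk, hxk⟩ := Finset.mem_biUnion.1 hxS
      obtain ⟨hkT, hkg⟩ := Finset.mem_filter.1 (hS hk)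
      rw [Finset.mem_filter, ← hkg]
      exact ⟨Finset.mem_univ _, Finset.mem_product.2
        ⟨floor_mem_Icc (hx k hkT x hxk), floor_mem_Icc (hy k hkT x hxk)⟩⟩
    have hVρ : ρ / 2 ≤ V := by
      have := hcl {k0} (by simpa using hk0) (by
        intro k hk k' hk' hne
        rw [Finset.mem_singleton] at hk hk'
        exact absurd (hk.trans hk'.symm) hne)
      simpa using this
    have hcard : (Tg.card : ℝ) * (ρ / 2) ≤ V * (2 ^ n) ^ 2 := by
      have h1 : Tg.card = ∑ h ∈ Tg.image (gridCell px py (j + 4)),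
          (Tg.filter fun k => gridCell px py (j + 4) k = h).card :=
        Finset.card_eq_sum_card_image _ _
      rw [h1, Nat.cast_sum, Finset.sum_mul]
      have h2 : ∑ h ∈ Tg.image (gridCell px py (j + 4)),
          ((Tg.filter fun k => gridCell px py (j + 4) k = h).card : ℝ) * (ρ / 2)
          ≤ (Tg.image (gridCell px py (j + 4))).card • V := by
        refine Finset.sum_le_card_nsmul _ _ _ fun h _ => hcl _ (Finset.filter_subset _ _) ?_
        intro k hk k' hk' hne
        obtain ⟨hk1, hk2⟩ := Finset.mem_filter.1 hk
        obtain ⟨hk1', hk2'⟩ := Finset.mem_filter.1 hk'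
        exact hdisj k (Finset.mem_filter.1 hk1).1 k' (Finset.mem_filter.1 hk1').1
          (hk2.trans hk2'.symm) hne
      refine h2.trans ?_
      rw [nsmul_eq_mul, mul_comm]
      refine mul_le_mul_of_nonneg_left ?_ hV0
      have := card_gridCell_image_le px py i n Tg g fun k hk => (Finset.mem_filter.1 hk).2
      rw [hn]
      exact_mod_cast this
    have hcard' : (Tg.card : ℝ) ≤ Fintype.card α := by exact_mod_cast Finset.card_le_univ Tg
    -- The square root arises here: one factor of the squared count is bounded by packing and the
    -- other trivially by the number of points, and ρ ≤ 2V removes ρ.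
    refine le_of_sq_le_sq ?_ (by positivity)
    have h3 : (32 * √(Fintype.card α) * V) ^ 2 = 1024 * Fintype.card α * V ^ 2 := by
      rw [mul_pow, mul_pow, Real.sq_sqrt (Nat.cast_nonneg _)]
      norm_num
    rw [h3]
    set N : ℝ := (Fintype.card α : ℝ)
    have hN0 : 0 ≤ N := Nat.cast_nonneg _
    have hc0 : (0 : ℝ) ≤ Tg.card := Nat.cast_nonneg _
    have h4 : δ ^ 2 * Tg.card * ρ ≤ 512 * ρ ^ 2 * V := by
      have := mul_le_mul_of_nonneg_left hcard (by positivity : 0 ≤ 2 * δ ^ 2)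
      have h5 : 2 * δ ^ 2 * (V * (2 ^ n) ^ 2) = 2 * V * (δ * 2 ^ n) ^ 2 := by ring
      rw [h5, hδρ] at this
      linarith
    have h5 : δ ^ 2 * Tg.card ≤ 512 * ρ * V := by
      refine le_of_mul_le_mul_right ?_ hρ0
      linarith
    calc (δ * (Tg.card : ℝ)) ^ 2 = δ ^ 2 * Tg.card * Tg.card := by ring
      _ ≤ 512 * ρ * V * N := mul_le_mul h5 hcard' hc0 (by positivity)
      _ ≤ 512 * (2 * V) * V * N := by gcongr; linarith
      _ = 1024 * N * V ^ 2 := by ring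
  have h1 : (T.card : ℝ) = ∑ g ∈ T.image (gridCell px py i),
      ((T.filter fun k => gridCell px py i k = g).card : ℝ) := by
    rw [← Nat.cast_sum, ← Finset.card_eq_sum_card_image]
  rw [h1, Finset.mul_sum]
  calc ∑ g ∈ T.image (gridCell px py i), δ * ((T.filter fun k => gridCell px py i k = g).card : ℝ)
      ≤ ∑ g ∈ T.image (gridCell px py i), 32 * √(Fintype.card α) * nearWeight px py o i g :=
        Finset.sum_le_sum fun g _ => hcell g
    _ = 32 * √(Fintype.card α) * ∑ g ∈ T.image (gridCell px py i), nearWeight px py o i g := by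
        rw [Finset.mul_sum]
    _ ≤ 32 * √(Fintype.card α) * (81 * 1) := by
        gcongr
        exact (sum_nearWeight_le px py o ho i _).trans (by linarith)
    _ = 2592 * √(Fintype.card α) := by ring

/-! ### Summing the waiting times over all scales. -/

/-- The data extracted from a run: a weight `o x` for each request `x` (its distance to its partner
in a perfect matching, normalized to total at most `1`), its waiting time `w x`, its rank in the
processing order, and the alternating sets at the moment each request is processed. -/
structure AlternatingFamily {α : Type*} (px py o w : α → ℝ) (rank : α → ℕ)
    (E : α → α → Finset α) : Prop where
  weight_nonneg : ∀ x, 0 ≤ o x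
  near : ∀ k q, rank k ≤ rank q → ∀ x ∈ E k q,
    |px q - px x| + |py q - py x| ≤ 4 * ∑ z ∈ E k q, o z
  wait_le : ∀ k q, rank k ≤ rank q →
    w k ≤ ∑ z ∈ E k q, o z + (|px q - px k| + |py q - py k|)
  disjoint : ∀ k q q', rank k ≤ rank q → rank k ≤ rank q' → q ≠ q' → Disjoint (E k q) (E k q')

namespace AlternatingFamily

variable {α : Type*} [Fintype α] {px py o w : α → ℝ} {rank : α → ℕ} {E : α → α → Finset α}

theorem wait_le_sum (h : AlternatingFamily px py o w rank E) (k : α) : w k ≤ ∑ x, o x := by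
  have h1 := h.wait_le k k le_rfl
  simp only [sub_self, abs_zero, add_zero] at h1
  exact h1.trans (Finset.sum_le_sum_of_subset_of_nonneg (Finset.subset_univ _)
    fun x _ _ => h.weight_nonneg x)

/-- In each fine cell the member of least rank is the leader, and every member is given its
alternating set at the moment the leader is processed. Members of one cell then have disjoint sets.
The weights of these sets fall into j + 2 dyadic levels, and the packing bound applies to each
level. -/
theorem scale_bound (h : AlternatingFamily px py o w rank E) (hsum : ∑ x, o x ≤ 1) (j : ℕ)
    (T : Finset α) (hT : ∀ k ∈ T, (1 / 2 : ℝ) ^ (j + 1) < w k) :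
    (1 / 2 : ℝ) ^ j * T.card ≤ (j + 2) * (2592 * √(Fintype.card α)) := by
  classical
  rcases T.eq_empty_or_nonempty with rfl | ⟨k0, hk0⟩
  · simp only [Finset.card_empty, Nat.cast_zero, mul_zero]
    positivity
  have hlead : ∀ g : ℤ × ℤ, ∃ l, ∀ k ∈ T, gridCell px py (j + 4) k = g →
      l ∈ T ∧ gridCell px py (j + 4) l = g ∧ rank l ≤ rank k := by
    intro g
    rcases (T.filter fun k => gridCell px py (j + 4) k = g).eq_empty_or_nonempty with he | hne
    · refine ⟨k0, fun k hk hkg => ?_⟩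
      exact absurd (Finset.mem_filter.2 ⟨hk, hkg⟩) (by rw [he]; simp)
    · obtain ⟨l, hl, hmin⟩ := Finset.exists_min_image _ rank hne
      obtain ⟨hl1, hl2⟩ := Finset.mem_filter.1 hl
      exact ⟨l, fun k hk hkg => ⟨hl1, hl2, hmin k (Finset.mem_filter.2 ⟨hk, hkg⟩)⟩⟩
  choose lead hlead using hlead
  let F : α → Finset α := fun k => E (lead (gridCell px py (j + 4) k)) k
  have hrank : ∀ k ∈ T, rank (lead (gridCell px py (j + 4) k)) ≤ rank k := fun k hk =>
    (hlead _ k hk rfl).2.2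
  have hF1 : ∀ k ∈ T, ∑ x ∈ F k, o x ≤ 1 := fun k _ =>
    (Finset.sum_le_sum_of_subset_of_nonneg (Finset.subset_univ _)
      fun x _ _ => h.weight_nonneg x).trans hsum
  -- The leader has waited more than δ/2 for δ = 2⁻ʲ, and is within 2 · δ/16 of the member; δ/2 −
  -- δ/8 exceeds δ/4.
  have hF2 : ∀ k ∈ T, (1 / 2 : ℝ) ^ (j + 2) < ∑ x ∈ F k, o x := by
    intro k hk
    obtain ⟨hl1, hl2, hl3⟩ := hlead _ k hk rfl
    have h1 := h.wait_le _ _ hl3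
    have h2 := hT _ hl1
    have h3 := abs_sub_le_of_floor_eq (congrArg Prod.fst hl2).symm
    have h4 := abs_sub_le_of_floor_eq (congrArg Prod.snd hl2).symm
    have e1 : (1 / 2 : ℝ) ^ (j + 1) = (1 / 2) ^ j / 2 := by rw [pow_add]; ring
    have e2 : (1 / 2 : ℝ) ^ (j + 2) = (1 / 2) ^ j / 4 := by rw [pow_add]; ring
    have e3 : (1 / 2 : ℝ) ^ (j + 4) = (1 / 2) ^ j / 16 := by rw [pow_add]; ring
    have e4 : (0 : ℝ) < (1 / 2) ^ j := by positivity
    rw [e1] at h2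
    rw [e2]
    rw [e3] at h3 h4
    simp only [F]
    linarith
  have hlevel : ∀ k ∈ T, ∃ i, i < j + 2 ∧ (1 / 2 : ℝ) ^ (i + 1) < ∑ x ∈ F k, o x ∧
      ∑ x ∈ F k, o x ≤ (1 / 2) ^ i := fun k hk => exists_dyadic_level _ (hF1 k hk) (hF2 k hk)
  let Ti : ℕ → Finset α := fun i => T.filter fun k => (1 / 2 : ℝ) ^ (i + 1) < ∑ x ∈ F k, o x ∧
      ∑ x ∈ F k, o x ≤ (1 / 2) ^ i
  have hcover : T ⊆ (Finset.range (j + 2)).biUnion Ti := by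
    intro k hk
    obtain ⟨i, hi, h'⟩ := hlevel k hk
    exact Finset.mem_biUnion.2 ⟨i, Finset.mem_range.2 hi, Finset.mem_filter.2 ⟨hk, h'⟩⟩
  have hTi : ∀ i ∈ Finset.range (j + 2),
      (1 / 2 : ℝ) ^ j * (Ti i).card ≤ 2592 * √(Fintype.card α) := by
    intro i hi
    rw [Finset.mem_range] at hi
    have hnear : ∀ k ∈ Ti i, ∀ x ∈ F k, |px k - px x| + |py k - py x| ≤ 4 * (1 / 2) ^ i := by
      intro k hk x hx
      obtain ⟨hk1, hk2⟩ := Finset.mem_filter.1 hk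
      have := h.near _ _ (hrank k hk1) x hx
      exact this.trans (mul_le_mul_of_nonneg_left hk2.2 (by norm_num))
    refine card_le_of_disjoint_nearby px py o h.weight_nonneg hsum (by omega) (Ti i) F
      (fun k hk => (Finset.mem_filter.1 hk).2.1.le) ?_ ?_ ?_
    · intro k hk x hx
      linarith [hnear k hk x hx, abs_nonneg (py k - py x)]
    · intro k hk x hx
      linarith [hnear k hk x hx, abs_nonneg (px k - px x)]
    · intro k hk k' hk' hkk hne
      have h1 := hrank k (Finset.mem_filter.1 hk).1
      have h2 := hrank k' (Finset.mem_filter.1 hk').1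
      simp only [F]
      rw [hkk] at h1 ⊢
      exact h.disjoint _ _ _ h1 h2 hne
  have hcard : (T.card : ℝ) ≤ ∑ i ∈ Finset.range (j + 2), ((Ti i).card : ℝ) := by
    exact_mod_cast (Finset.card_le_card hcover).trans Finset.card_biUnion_le
  calc (1 / 2 : ℝ) ^ j * T.card
      ≤ (1 / 2 : ℝ) ^ j * ∑ i ∈ Finset.range (j + 2), ((Ti i).card : ℝ) := by gcongr
    _ = ∑ i ∈ Finset.range (j + 2), (1 / 2 : ℝ) ^ j * (Ti i).card := Finset.mul_sum _ _ _
    _ ≤ (Finset.range (j + 2)).card • (2592 * √(Fintype.card α)) :=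
        Finset.sum_le_card_nsmul _ _ _ hTi
    _ = (j + 2) * (2592 * √(Fintype.card α)) := by
        rw [Finset.card_range, nsmul_eq_mul]; push_cast; ring

/-- Waiting times of at most `2⁻ᴶ` contribute at most 1 altogether, and the others lie in `J` dyadic
scales, each contributing at most (J + 1) · 2592 √n. -/
theorem sum_wait_le_of_sum_le_one (h : AlternatingFamily px py o w rank E) (hsum : ∑ x, o x ≤ 1)
    {J : ℕ} (hJ : Fintype.card α ≤ 2 ^ J) :
    ∑ k, w k ≤ 1 + 2592 * J * (J + 1) * √(Fintype.card α) := by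
  classical
  let T : ℕ → Finset α := fun j => Finset.univ.filter fun k =>
    (1 / 2 : ℝ) ^ (j + 1) < w k ∧ w k ≤ (1 / 2) ^ j
  let R : ℝ := √(Fintype.card α)
  have hpt : ∀ k, w k ≤ (1 / 2 : ℝ) ^ J
      + ∑ j ∈ Finset.range J, if k ∈ T j then (1 / 2 : ℝ) ^ j else 0 := by
    intro k
    have hnn : ∀ j ∈ Finset.range J, (0 : ℝ) ≤ if k ∈ T j then (1 / 2 : ℝ) ^ j else 0 := by
      intro j _
      split_ifs <;> positivity
    by_cases hk : (1 / 2 : ℝ) ^ J < w k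
    · obtain ⟨j, hj, hj'⟩ := exists_dyadic_level J ((h.wait_le_sum k).trans hsum) hk
      have h1 := Finset.single_le_sum hnn (Finset.mem_range.2 hj)
      rw [if_pos (show k ∈ T j from Finset.mem_filter.2 ⟨Finset.mem_univ _, hj'⟩)] at h1
      have : (0 : ℝ) < (1 / 2) ^ J := by positivity
      linarith [hj'.2]
    · have := Finset.sum_nonneg hnn
      linarith
  have h1 : ∑ k, w k ≤ (Fintype.card α : ℝ) * (1 / 2) ^ J
      + ∑ j ∈ Finset.range J, (1 / 2 : ℝ) ^ j * (T j).card := by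
    refine (Finset.sum_le_sum fun k _ => hpt k).trans ?_
    rw [Finset.sum_add_distrib, Finset.sum_const, nsmul_eq_mul, Finset.card_univ,
      Finset.sum_comm]
    refine le_of_eq ?_
    congr 1
    refine Finset.sum_congr rfl fun j _ => ?_
    rw [← Finset.sum_filter, Finset.sum_const, nsmul_eq_mul, mul_comm]
    congr 3
    ext k
    simp
  have h2 : (Fintype.card α : ℝ) * (1 / 2) ^ J ≤ 1 := by
    have : (Fintype.card α : ℝ) ≤ 2 ^ J := by exact_mod_cast hJ
    calc (Fintype.card α : ℝ) * (1 / 2) ^ J ≤ 2 ^ J * (1 / 2) ^ J := by gcongr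
      _ = 1 := by rw [← mul_pow]; norm_num
  have h3 : ∑ j ∈ Finset.range J, (1 / 2 : ℝ) ^ j * (T j).card
      ≤ (Finset.range J).card • ((J + 1) * (2592 * R)) := by
    refine Finset.sum_le_card_nsmul _ _ _ fun j hj => ?_
    rw [Finset.mem_range] at hj
    refine (h.scale_bound hsum j (T j) fun k hk => (Finset.mem_filter.1 hk).2.1).trans ?_
    have : (j : ℝ) + 2 ≤ J + 1 := by
      have : ((j + 2 : ℕ) : ℝ) ≤ (J + 1 : ℕ) := Nat.cast_le.2 (by omega)
      push_cast at this
      linarith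
    exact mul_le_mul_of_nonneg_right this (by positivity)
  rw [Finset.card_range, nsmul_eq_mul] at h3
  calc ∑ k, w k ≤ 1 + J * ((J + 1) * (2592 * R)) := by linarith
    _ = 1 + 2592 * J * (J + 1) * R := by ring

/-- All the conditions are homogeneous, so everything is divided by the total weight; if that is 0,
no waiting time is positive. -/
theorem sum_wait_le (h : AlternatingFamily px py o w rank E)
    {J : ℕ} (hJ : Fintype.card α ≤ 2 ^ J) :
    ∑ k, w k ≤ (1 + 2592 * J * (J + 1) * √(Fintype.card α)) * ∑ x, o x := by
  have hW0 : 0 ≤ ∑ x, o x := Finset.sum_nonneg fun x _ => h.weight_nonneg x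
  rcases hW0.eq_or_lt with hW | hW
  · rw [← hW, mul_zero]
    exact Finset.sum_nonpos fun k _ => (h.wait_le_sum k).trans hW.ge
  set W := ∑ x, o x with hWdef
  have h' : AlternatingFamily (fun x => px x / W) (fun x => py x / W) (fun x => o x / W)
      (fun x => w x / W) rank E := by
    refine ⟨fun x => div_nonneg (h.weight_nonneg x) hW.le, ?_, ?_, h.disjoint⟩
    · intro k q hkq x hx
      have := h.near k q hkq x hx
      rw [← Finset.sum_div, ← sub_div, ← sub_div, abs_div, abs_div, abs_of_pos hW, ← add_div,
        ← mul_div_assoc]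
      gcongr
    · intro k q hkq
      have := h.wait_le k q hkq
      rw [← Finset.sum_div, ← sub_div, ← sub_div, abs_div, abs_div, abs_of_pos hW, ← add_div,
        ← add_div]
      gcongr
  have := h'.sum_wait_le_of_sum_le_one (by rw [← Finset.sum_div, div_self hW.ne']) hJ
  rwa [← Finset.sum_div, div_le_iff₀ hW] at this

end AlternatingFamily

/-! ### From an execution to its cost. -/

theorem Solution.sum_dist_le_cost {I : Instance m} (S : Solution I) :
    ∑ r, I.dist r (S.server r) ≤ S.cost := by
  refine Finset.sum_le_sum fun r _ => ?_
  have h1 := S.reqTime_le r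
  have h2 := S.srvTime_le r
  have : |I.reqTime r - I.srvTime (S.server r)|
      ≤ (S.time r - I.reqTime r) + (S.time r - I.srvTime (S.server r)) :=
    abs_le.2 ⟨by linarith, by linarith⟩
  unfold Instance.dist
  linarith

/-- The delay of the server is that of the request plus the difference of arrival times, which the
Manhattan distance absorbs. -/
theorem Solution.cost_le_sum {I : Instance m} (S : Solution I) :
    S.cost ≤ ∑ r, (2 * (S.time r - I.reqTime r) + I.dist r (S.server r)) := by
  refine Finset.sum_le_sum fun r _ => ?_
  have := le_abs_self (I.reqTime r - I.srvTime (S.server r))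
  unfold Instance.dist
  linarith

/-- Before any request has arrived, zero duals are feasible. -/
theorem exists_isDual_empty (I : Instance m) (γ T : ℝ) (hγ : 0 ≤ γ) :
    ∃ t ≤ T, IsDual I γ ∅ t (fun _ => 0) (fun _ => 0) := by
  obtain ⟨b, hb⟩ := (Set.finite_range I.reqTime).bddBelow
  have hmax : ∀ r, max 0 (min b T - I.reqTime r) = 0 := fun r =>
    max_eq_left (by linarith [hb (Set.mem_range_self r), min_le_left b T])
  refine ⟨min b T, min_le_right _ _, ⟨?_, by simp, by simp, by simp, ?_, ?_⟩⟩
  · intro r s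
    simpa using mul_nonneg hγ (I.dist_nonneg r s)
  · intro r _
    rw [hmax, mul_zero]
  · intro r
    rw [hmax, mul_zero]

namespace Execution

variable {γ : ℝ} {I : Instance m} {S : Solution I}

theorem isAlternating (X : Execution γ I S) (k : Fin m) :
    IsAlternating (X.off k) (X.req k) (S.server (X.req k)) (X.path k) ∧
      ∀ e ∈ X.off k, e.2 ≠ S.server (X.req k) := by
  obtain ⟨s, h1, h2, -, -⟩ := Instance.isAugPath_iff.1 (X.ready k).1.1
  have := h1.terminus_eq
  rw [X.terminus k, Option.some_inj] at this
  rw [this]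
  exact ⟨h1, h2⟩

theorem isMatching_off (X : Execution γ I S) : ∀ k ≤ m, IsMatching (X.off k) := by
  intro k
  induction k with
  | zero => intro _; rw [X.off_zero]; exact isMatching_empty
  | succ k ih =>
    intro hk
    have h := X.isAlternating ⟨k, hk⟩
    rw [X.off_succ ⟨k, hk⟩]
    exact h.1.isMatching_symmDiff h.2 (ih (by omega))

theorem saturated_request_iff (X : Execution γ I S) (x : Fin m) : ∀ k ≤ m,
    ((∃ e ∈ X.off k, e.1 = x) ↔ ∃ j : Fin m, (j : ℕ) < k ∧ X.req j = x) := by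
  intro k
  induction k with
  | zero => intro _; simp [X.off_zero]
  | succ k ih =>
    intro hk
    rw [X.off_succ ⟨k, hk⟩, (X.isAlternating ⟨k, hk⟩).1.saturates_request_iff, ih (by omega)]
    constructor
    · rintro (rfl | ⟨j, hj, rfl⟩)
      · exact ⟨⟨k, hk⟩, Nat.lt_succ_self k, rfl⟩
      · exact ⟨j, by omega, rfl⟩
    · rintro ⟨j, hj, rfl⟩
      rcases Nat.lt_succ_iff_lt_or_eq.1 hj with h | h
      · exact Or.inr ⟨j, h, rfl⟩
      · exact Or.inl (congrArg X.req (Fin.ext h))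

theorem saturated_server_iff (X : Execution γ I S) (x : Fin m) : ∀ k ≤ m,
    ((∃ e ∈ X.off k, e.2 = x) ↔ ∃ j : Fin m, (j : ℕ) < k ∧ S.server (X.req j) = x) := by
  intro k
  induction k with
  | zero => intro _; simp [X.off_zero]
  | succ k ih =>
    intro hk
    rw [X.off_succ ⟨k, hk⟩, (X.isAlternating ⟨k, hk⟩).1.saturates_server_iff, ih (by omega)]
    constructor
    · rintro (rfl | ⟨j, hj, rfl⟩)
      · exact ⟨⟨k, hk⟩, Nat.lt_succ_self k, rfl⟩
      · exact ⟨j, by omega, rfl⟩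
    · rintro ⟨j, hj, rfl⟩
      rcases Nat.lt_succ_iff_lt_or_eq.1 hj with h | h
      · exact Or.inr ⟨j, h, rfl⟩
      · exact Or.inl (congrArg (fun i => S.server (X.req i)) (Fin.ext h))

theorem req_injective (X : Execution γ I S) : Function.Injective X.req := by
  have key : ∀ i j : Fin m, i < j → X.req i ≠ X.req j := by
    intro i j hij h
    obtain ⟨e, he, hej⟩ := (X.saturated_request_iff (X.req j) j j.2.le).2 ⟨i, hij, h⟩
    exact (X.isAlternating j).1.origin_free e he hej
  intro i j h
  rcases lt_trichotomy i j with hij | hij | hij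
  · exact absurd h (key i j hij)
  · exact hij
  · exact absurd h.symm (key j i hij)

/-- The duals are taken just before the `k`-th augmentation: augment at the previous one, then grow
over the interval in which `prompt` excludes ready requests. -/
theorem exists_isDual (X : Execution γ I S) (hγ : 1 ≤ γ) : ∀ (k : ℕ) (hk : k < m),
    ∃ yr ys, IsDual I γ (X.off k) (S.time (X.req ⟨k, hk⟩)) yr ys := by
  have hγ0 : 0 < γ := by linarith
  intro k
  induction k with
  | zero =>
    intro hk
    obtain ⟨t, ht, hy⟩ := exists_isDual_empty I γ (S.time (X.req ⟨0, hk⟩)) hγ0.le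
    rw [X.off_zero]
    refine hy.grow hγ0 ht isMatching_empty (by simp) ?_
    intro t'' _ ht'' r P
    have := X.prompt ⟨0, hk⟩ t'' (fun j hj => absurd hj (Nat.not_lt_zero _)) ht'' r P
    rwa [show ((⟨0, hk⟩ : Fin m) : ℕ) = 0 from rfl, X.off_zero] at this
  | succ k ih =>
    intro hk
    have hk' : k < m := by omega
    obtain ⟨yr, ys, hy⟩ := ih hk'
    obtain ⟨yr', ys', hy'⟩ := hy.augment hγ (X.isMatching_off k hk'.le) (X.ready ⟨k, hk'⟩)
    rw [← X.off_succ ⟨k, hk'⟩] at hy'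
    have hmono : ∀ j : Fin m, (j : ℕ) < k + 1 → S.time (X.req j) ≤ S.time (X.req ⟨k, hk'⟩) :=
      fun j hj => X.time_mono _ _ (Nat.lt_succ_iff.1 hj)
    refine hy'.grow hγ0 (X.time_mono ⟨k, hk'⟩ ⟨k + 1, hk⟩ (Nat.le_succ k))
      (X.isMatching_off (k + 1) hk.le) ?_ ?_
    · intro e he
      obtain ⟨i, hi, hie⟩ := (X.saturated_request_iff e.1 (k + 1) hk.le).1 ⟨e, he, rfl⟩
      obtain ⟨j, hj, hje⟩ := (X.saturated_server_iff e.2 (k + 1) hk.le).1 ⟨e, he, rfl⟩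
      rw [← hie, ← hje]
      exact ⟨(S.reqTime_le _).trans (hmono i hi), (S.srvTime_le _).trans (hmono j hj)⟩
    · intro t'' h1 h2 r P
      exact X.prompt ⟨k + 1, hk⟩ t'' (fun j hj => (hmono j hj).trans h1) h2 r P

theorem exists_alternatingFamily (X : Execution 3 I S) (σ : Equiv.Perm (Fin m)) :
    ∃ rank E, AlternatingFamily I.reqPos I.reqTime (fun r => I.dist r (σ r))
      (fun r => S.time r - I.reqTime r) rank E := by
  let e : Fin m ≃ Fin m := Equiv.ofBijective X.req (Finite.injective_iff_bijective.1 X.req_injective)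
  have hdual := fun k : Fin m => X.exists_isDual (by norm_num) k k.2
  choose yr ys hy using hdual
  have hE := fun k : Fin m => (hy k).exists_alternating_sets (by norm_num)
    (X.isMatching_off k k.2.le) σ
  choose E hE1 hE2 using hE
  -- When `k` is processed, the unsaturated requests are exactly those of rank at least that of `k`,
  -- including `k` itself.
  have hfree : ∀ k q : Fin m, ((e.symm k : Fin m) : ℕ) ≤ (e.symm q : Fin m) →
      ∀ f ∈ X.off (e.symm k : Fin m), f.1 ≠ q := by
    intro k q hkq f hf hfq
    obtain ⟨j, hj, hjq⟩ := (X.saturated_request_iff q _ (e.symm k).2.le).1 ⟨f, hf, hfq⟩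
    have : e.symm q = j := by rw [Equiv.symm_apply_eq]; exact hjq.symm
    rw [this] at hkq
    omega
  refine ⟨fun q => (e.symm q : Fin m), fun k q => E (e.symm k) q,
    ⟨fun r => I.dist_nonneg _ _, ?_, ?_, ?_⟩⟩
  · intro k q hkq x hx
    have := (hE2 (e.symm k) q (hfree k q hkq)).1 x hx
    norm_num at this
    exact this
  · intro k q hkq
    have h1 := (hE2 (e.symm k) q (hfree k q hkq)).2 k (hfree k k le_rfl)
    have h2 := (hy (e.symm k)).req_free k (hfree k k le_rfl)
    have h3 : X.req ⟨(e.symm k : Fin m), (e.symm k).2⟩ = k := e.apply_symm_apply k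
    rw [h3] at h2
    have h4 := le_max_right 0 (S.time k - I.reqTime k)
    unfold Instance.reqDist at h1
    linarith
  · intro k q q' h1 h2 hne
    exact hE1 (e.symm k) q q' (hfree k q h1) (hfree k q' h2) hne

/-- The matching cost of a run is charged to its waiting times. -/
theorem sum_dist_le (X : Execution 3 I S) :
    ∑ r, I.dist r (S.server r) ≤ 3 * ∑ r, (S.time r - I.reqTime r) := by
  let e : Fin m ≃ Fin m := Equiv.ofBijective X.req (Finite.injective_iff_bijective.1 X.req_injective)
  have he : ∀ k, e k = X.req k := fun k => rfl
  let c : ℕ → ℝ := fun k => ∑ f ∈ X.off k, I.dist f.1 f.2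
  -- F + B = (3F − B) − 2(F − B), where F − B is the change of the offline length `c`.
  have hk : ∀ k : Fin m, I.dist (e k) (S.server (e k))
      ≤ 3 * (S.time (e k) - I.reqTime (e k)) - 2 * (c (k + 1) - c k) := by
    intro k
    have h := (X.isAlternating k).1
    have h1 := I.dist_le_length (X.path k) _ _ h.origin_eq h.terminus_eq
    have h2 := h.sum_symmDiff fun f => I.dist f.1 f.2
    have h3 := (X.ready k).2
    rw [← X.off_succ k] at h2
    rw [div_le_iff₀ (by norm_num)] at h3
    unfold Instance.netCost at h3
    rw [he]
    simp only [c]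
    linarith
  rw [← Equiv.sum_comp e, ← Equiv.sum_comp e (fun r => S.time r - I.reqTime r)]
  refine (Finset.sum_le_sum fun k _ => hk k).trans ?_
  rw [Finset.sum_sub_distrib, ← Finset.mul_sum, ← Finset.mul_sum,
    Fin.sum_univ_eq_sum_range (fun k => c (k + 1) - c k) m, Finset.sum_range_sub]
  have h0 : c 0 = 0 := by simp [c, X.off_zero]
  have hm : 0 ≤ c m := Finset.sum_nonneg fun f _ => I.dist_nonneg _ _
  linarith

theorem cost_le (X : Execution 3 I S) (S' : Solution I) {J : ℕ} (hJ : m ≤ 2 ^ J) :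
    S.cost ≤ 5 * (1 + 2592 * J * (J + 1) * √m) * S'.cost := by
  obtain ⟨rank, E, hF⟩ := X.exists_alternatingFamily S'.server
  have h1 := hF.sum_wait_le (J := J) (by rwa [Fintype.card_fin])
  rw [Fintype.card_fin] at h1
  have h2 := S.cost_le_sum
  rw [Finset.sum_add_distrib, ← Finset.mul_sum] at h2
  have h3 := X.sum_dist_le
  have h4 := mul_le_mul_of_nonneg_left S'.sum_dist_le_cost
    (by positivity : (0 : ℝ) ≤ 1 + 2592 * J * (J + 1) * √m)
  linarith

theorem cost_le_optCost (X : Execution 3 I S) {J : ℕ} (hJ : m ≤ 2 ^ J) :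
    S.cost ≤ 5 * (1 + 2592 * J * (J + 1) * √m) * I.optCost := by
  have hpos : (0 : ℝ) < 5 * (1 + 2592 * J * (J + 1) * √m) := by positivity
  rw [← div_le_iff₀' hpos]
  refine le_ciInf fun S' => ?_
  rw [div_le_iff₀' hpos]
  exact X.cost_le S' hJ

end Execution

/-! ### Construction of the algorithm. -/

/-- A numbering of the paths that depends only on the labels of their vertices. -/
def AltPath.code (P : AltPath m) : ℕ :=
  Encodable.encode (P.map fun e => ((e.1 : ℕ), (e.2 : ℕ)))

theorem AltPath.code_injective : Function.Injective (AltPath.code (m := m)) := by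
  intro P Q h
  refine List.map_injective_iff.2 ?_ (Encodable.encode_injective h)
  rintro ⟨a, b⟩ ⟨c, d⟩ h
  simp only [Prod.mk.injEq] at h
  exact Prod.ext (Fin.ext h.1) (Fin.ext h.2)

/-- From the offline matching `M`, and not before the times in `F`, the next augmentation of the
algorithm is at time `τ` along `P`; ties are broken by the numbering of the paths. -/
structure Instance.IsNext (I : Instance m) (M : Finset (Fin m × Fin m)) (F : Set ℝ) (τ : ℝ)
    (P : AltPath m) : Prop where
  least : IsLeast {t | t ∈ F ∧ ∃ r Q, I.IsReady 3 M t r Q} τ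
  ready : ∃ r, I.IsReady 3 M τ r P
  first : ∀ r Q, I.IsReady 3 M τ r Q → P.code ≤ Q.code

theorem Instance.IsNext.unique {I : Instance m} {M : Finset (Fin m × Fin m)} {F : Set ℝ}
    {τ τ' : ℝ} {P P' : AltPath m} (h : I.IsNext M F τ P) (h' : I.IsNext M F τ' P') :
    τ = τ' ∧ P = P' := by
  obtain rfl := h.least.unique h'.least
  obtain ⟨r, hr⟩ := h.ready
  obtain ⟨r', hr'⟩ := h'.ready
  exact ⟨rfl, AltPath.code_injective (le_antisymm (h.first _ _ hr') (h'.first _ _ hr))⟩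

/-- For a fixed matching, an augmenting path can be used from the time `f` on, when its ends have
arrived and the waiting time covers the net-cost. So the times with a ready request form a closed
half-line starting at the minimum of `f`, and the least such time in `F` exists. -/
theorem Instance.exists_isNext (I : Instance m) {M : Finset (Fin m × Fin m)} {F : Set ℝ}
    (hF : F = Set.univ ∨ ∃ t, F = Set.Ici t) {r s : Fin m} (hr : ∀ e ∈ M, e.1 ≠ r)
    (hs : ∀ e ∈ M, e.2 ≠ s) : ∃ τ P, I.IsNext M F τ P := by
  let V : Set (Fin m × Fin m × AltPath m) :=
    {p | IsAlternating M p.1 p.2.1 p.2.2 ∧ ∀ e ∈ M, e.2 ≠ p.2.1}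
  have hV : V.Finite := by
    refine (Set.finite_univ.prod (Set.finite_univ.prod (finite_isAlternating M))).subset ?_
    rintro ⟨a, b, P⟩ h
    exact ⟨Set.mem_univ _, Set.mem_univ _, a, b, h.1⟩
  have hne : V.Nonempty := ⟨(r, s, [(r, s)]), ⟨rfl, rfl, hr, by simp, by simp,
    by simp only [List.mem_singleton, forall_eq]; exact fun h => hr _ h rfl,
    by simp [AltPath.backEdges]⟩, hs⟩
  let f : Fin m × Fin m × AltPath m → ℝ := fun p =>
    max (max (I.reqTime p.1) (I.srvTime p.2.1)) (I.reqTime p.1 + I.netCost 3 p.2.2 / 3)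
  obtain ⟨⟨r0, s0, P0⟩, hp0, hmin⟩ := Set.exists_min_image V f hV hne
  have hready : ∀ t, (∃ r Q, I.IsReady 3 M t r Q) ↔ f (r0, s0, P0) ≤ t := by
    intro t
    constructor
    · rintro ⟨a, Q, hQ⟩
      obtain ⟨b, hb, hb2, h1, h2⟩ := Instance.isAugPath_iff.1 hQ.1.1
      refine (hmin (a, b, Q) ⟨hb, hb2⟩).trans (max_le (max_le h1 h2) ?_)
      have := hQ.2
      dsimp only
      linarith
    · intro h
      have h1 := (le_max_left _ _).trans h
      have h2 : I.reqTime r0 + I.netCost 3 P0 / 3 ≤ t := (le_max_right _ _).trans h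
      refine ⟨r0, Instance.exists_isReady (by norm_num) (Instance.isAugPath_iff.2
        ⟨s0, hp0.1, hp0.2, (le_max_left _ _).trans h1, (le_max_right _ _).trans h1⟩) ?_⟩
      linarith
  obtain ⟨τ, hτ⟩ : ∃ τ, IsLeast {t | t ∈ F ∧ ∃ r Q, I.IsReady 3 M t r Q} τ := by
    simp_rw [hready]
    rcases hF with rfl | ⟨t0, rfl⟩
    · exact ⟨f (r0, s0, P0), ⟨Set.mem_univ _, le_rfl⟩, fun t ht => ht.2⟩
    · exact ⟨max t0 (f (r0, s0, P0)), ⟨Set.mem_Ici.2 (le_max_left _ _), le_max_right _ _⟩,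
        fun t ht => max_le ht.1 ht.2⟩
  obtain ⟨P, hP, hPmin⟩ := exists_minimalFor_of_wellFoundedLT
    (fun P : AltPath m => ∃ r, I.IsReady 3 M τ r P) AltPath.code
    (by obtain ⟨a, Q, h⟩ := hτ.1.2; exact ⟨Q, a, h⟩)
  refine ⟨τ, P, hτ, hP, fun a Q hQ => ?_⟩
  rcases le_total P.code Q.code with h | h
  · exact h
  · exact hPmin ⟨a, hQ⟩ h

open Classical in
/-- The time and the path of the next augmentation. -/
noncomputable def Instance.next (I : Instance m) (M : Finset (Fin m × Fin m)) (F : Set ℝ) :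
    ℝ × AltPath m :=
  -- The default is never used in the first `m` steps, by `isNext_trace`.
  if h : ∃ p : ℝ × AltPath m, I.IsNext M F p.1 p.2 then h.choose else (0, [])

theorem Instance.next_eq {I : Instance m} {M : Finset (Fin m × Fin m)} {F : Set ℝ} {τ : ℝ}
    {P : AltPath m} (h : I.IsNext M F τ P) : I.next M F = (τ, P) := by
  have hex : ∃ p : ℝ × AltPath m, I.IsNext M F p.1 p.2 := ⟨(τ, P), h⟩
  unfold Instance.next
  rw [dif_pos hex]
  exact Prod.ext (hex.choose_spec.unique h).1 (hex.choose_spec.unique h).2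

/-- The offline matching after `k` augmentations, and the times that are not before the last of
them. -/
noncomputable def Instance.trace (I : Instance m) : ℕ → Finset (Fin m × Fin m) × Set ℝ
  | 0 => (∅, Set.univ)
  | k + 1 =>
    let p := I.next (I.trace k).1 (I.trace k).2
    (symmDiff (I.trace k).1 (AltPath.edges p.2), Set.Ici p.1)

/-- The invariant of the algorithm after `k` augmentations. -/
structure Instance.IsState (I : Instance m) (k : ℕ) (M : Finset (Fin m × Fin m)) (F : Set ℝ) :
    Prop where
  isMatching : IsMatching M
  card_fst : (M.image Prod.fst).card = k
  card_snd : (M.image Prod.snd).card = k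
  floor : F = Set.univ ∨ ∃ t, F = Set.Ici t
  arrived : ∀ e ∈ M, ∀ t ∈ F, I.reqTime e.1 ≤ t ∧ I.srvTime e.2 ≤ t

namespace Instance.IsState

variable {I : Instance m} {k : ℕ} {M : Finset (Fin m × Fin m)} {F : Set ℝ}

theorem exists_isNext (h : I.IsState k M F) (hk : k < m) : ∃ τ P, I.IsNext M F τ P := by
  have key : ∀ T : Finset (Fin m), T.card = k → ∃ x, x ∉ T := by
    intro T hT
    by_contra hc
    push Not at hc
    rw [Finset.eq_univ_iff_forall.2 hc, Finset.card_univ, Fintype.card_fin] at hT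
    omega
  obtain ⟨r, hr⟩ := key _ h.card_fst
  obtain ⟨s, hs⟩ := key _ h.card_snd
  exact I.exists_isNext h.floor
    (fun e he hef => hr (Finset.mem_image.2 ⟨e, he, hef⟩))
    (fun e he hef => hs (Finset.mem_image.2 ⟨e, he, hef⟩))

/-- A ready request is unsaturated, whereas after `m` augmentations none is left. This lets two
inputs of different sizes be compared. -/
theorem lt_of_isNext (h : I.IsState k M F) {τ : ℝ} {P : AltPath m} (hn : I.IsNext M F τ P) :
    k < m := by
  obtain ⟨r, hr⟩ := hn.ready
  have : r ∉ M.image Prod.fst := by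
    intro hmem
    obtain ⟨e, he, hef⟩ := Finset.mem_image.1 hmem
    exact hr.1.1.free_origin.2 e he hef
  have h1 := Finset.card_lt_univ_of_notMem this
  rwa [h.card_fst, Fintype.card_fin] at h1

theorem step (h : I.IsState k M F) {τ : ℝ} {P : AltPath m} (hn : I.IsNext M F τ P) :
    I.IsState (k + 1) (symmDiff M (AltPath.edges P)) (Set.Ici τ) := by
  obtain ⟨r, hr⟩ := hn.ready
  obtain ⟨s, hs, hs2, h1, h2⟩ := Instance.isAugPath_iff.1 hr.1.1
  have hfst : (symmDiff M (AltPath.edges P)).image Prod.fst = insert r (M.image Prod.fst) := by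
    ext x
    rw [Finset.mem_insert, Finset.mem_image, Finset.mem_image]
    exact hs.saturates_request_iff x
  have hsnd : (symmDiff M (AltPath.edges P)).image Prod.snd = insert s (M.image Prod.snd) := by
    ext x
    rw [Finset.mem_insert, Finset.mem_image, Finset.mem_image]
    exact hs.saturates_server_iff x
  refine ⟨hs.isMatching_symmDiff hs2 h.isMatching, ?_, ?_, Or.inr ⟨τ, rfl⟩, ?_⟩
  · rw [hfst, Finset.card_insert_of_notMem, h.card_fst]
    intro hmem
    obtain ⟨e, he, hef⟩ := Finset.mem_image.1 hmem
    exact hs.origin_free e he hef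
  · rw [hsnd, Finset.card_insert_of_notMem, h.card_snd]
    intro hmem
    obtain ⟨e, he, hef⟩ := Finset.mem_image.1 hmem
    exact hs2 e he hef
  · intro e he t ht
    rw [Set.mem_Ici] at ht
    constructor
    · rcases (hs.saturates_request_iff e.1).1 ⟨e, he, rfl⟩ with h' | ⟨f, hf, hfe⟩
      · rw [h']; exact h1.trans ht
      · rw [← hfe]; exact (h.arrived f hf τ hn.least.1.1).1.trans ht
    · rcases (hs.saturates_server_iff e.2).1 ⟨e, he, rfl⟩ with h' | ⟨f, hf, hfe⟩
      · rw [h']; exact h2.trans ht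
      · rw [← hfe]; exact (h.arrived f hf τ hn.least.1.1).2.trans ht

end Instance.IsState

namespace Instance

/-- The time of the `k`-th augmentation. -/
noncomputable def stepTime (I : Instance m) (k : ℕ) : ℝ := (I.next (I.trace k).1 (I.trace k).2).1

/-- The path of the `k`-th augmentation. -/
noncomputable def stepPath (I : Instance m) (k : ℕ) : AltPath m :=
  (I.next (I.trace k).1 (I.trace k).2).2

theorem trace_succ (I : Instance m) (k : ℕ) : I.trace (k + 1) =
    (symmDiff (I.trace k).1 (AltPath.edges (I.stepPath k)), Set.Ici (I.stepTime k)) := rfl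

theorem isState_zero (I : Instance m) : I.IsState 0 (I.trace 0).1 (I.trace 0).2 :=
  ⟨isMatching_empty, rfl, rfl, Or.inl rfl, fun _ he => absurd he (Finset.notMem_empty _)⟩

theorem isState_trace (I : Instance m) :
    ∀ k ≤ m, I.IsState k (I.trace k).1 (I.trace k).2 := by
  intro k
  induction k with
  | zero => exact fun _ => I.isState_zero
  | succ k ih =>
    intro hk
    have h := ih (by omega)
    obtain ⟨τ, P, hn⟩ := h.exists_isNext hk
    have := h.step hn
    rw [trace_succ]
    unfold stepTime stepPath
    rw [next_eq hn]
    exact this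

theorem isNext_trace (I : Instance m) {k : ℕ} (hk : k < m) :
    I.IsNext (I.trace k).1 (I.trace k).2 (I.stepTime k) (I.stepPath k) := by
  obtain ⟨τ, P, hn⟩ := (I.isState_trace k hk.le).exists_isNext hk
  unfold stepTime stepPath
  rw [next_eq hn]
  exact hn

theorem stepTime_mono (I : Instance m) {j k : ℕ} (hjk : j ≤ k) (hk : k < m) :
    I.stepTime j ≤ I.stepTime k := by
  induction k, hjk using Nat.le_induction with
  | base => exact le_rfl
  | succ k hjk ih => exact (ih (by omega)).trans (I.isNext_trace hk).least.1.1

theorem exists_run (I : Instance m) : ∃ (S : Solution I) (X : Execution 3 I S),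
    ∀ k : Fin m, S.time (X.req k) = I.stepTime k ∧ X.path k = I.stepPath k := by
  have hready := fun k : Fin m => (I.isNext_trace k.2).ready
  choose req hready using hready
  have haug := fun k : Fin m => Instance.isAugPath_iff.1 (hready k).1.1
  choose srv halt hfree hreq hsrv using haug
  have hsat : ∀ j : Fin m, ∀ k : ℕ, (j : ℕ) + 1 ≤ k → k ≤ m →
      (∃ e ∈ (I.trace k).1, e.1 = req j) ∧ ∃ e ∈ (I.trace k).1, e.2 = srv j := by
    intro j k hjk
    induction k, hjk using Nat.le_induction with
    | base =>
      intro _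
      rw [trace_succ]
      exact ⟨((halt j).saturates_request_iff _).2 (Or.inl rfl),
        ((halt j).saturates_server_iff _).2 (Or.inl rfl)⟩
    | succ k hjk ih =>
      intro hk
      have := ih (by omega)
      rw [trace_succ]
      exact ⟨((halt ⟨k, hk⟩).saturates_request_iff _).2 (Or.inr this.1),
        ((halt ⟨k, hk⟩).saturates_server_iff _).2 (Or.inr this.2)⟩
  have hne : ∀ i j : Fin m, i < j → req i ≠ req j ∧ srv i ≠ srv j := by
    intro i j hij
    obtain ⟨⟨e, he, hei⟩, ⟨f, hf, hfi⟩⟩ := hsat i j hij j.2.le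
    exact ⟨fun h => (halt j).origin_free e he (hei.trans h), fun h => hfree j f hf (hfi.trans h)⟩
  have hreq_inj : Function.Injective req := by
    intro i j h
    rcases lt_trichotomy i j with hij | hij | hij
    · exact absurd h (hne i j hij).1
    · exact hij
    · exact absurd h.symm (hne j i hij).1
  have hsrv_inj : Function.Injective srv := by
    intro i j h
    rcases lt_trichotomy i j with hij | hij | hij
    · exact absurd h (hne i j hij).2
    · exact hij
    · exact absurd h.symm (hne j i hij).2
  let e : Fin m ≃ Fin m := Equiv.ofBijective req (Finite.injective_iff_bijective.1 hreq_inj)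
  let g : Fin m ≃ Fin m := Equiv.ofBijective srv (Finite.injective_iff_bijective.1 hsrv_inj)
  let S : Solution I := {
    server := e.symm.trans g
    time := fun r => I.stepTime (e.symm r : Fin m)
    reqTime_le := by
      intro r
      have := hreq (e.symm r)
      rwa [show req (e.symm r) = r from e.apply_symm_apply r] at this
    srvTime_le := fun r => hsrv (e.symm r) }
  have hsymm : ∀ k, e.symm (req k) = k := fun k => e.symm_apply_apply k
  have htime : ∀ k, S.time (req k) = I.stepTime k := fun k => by
    change I.stepTime (e.symm (req k) : Fin m) = _
    rw [hsymm]
  have hserver : ∀ k, S.server (req k) = srv k := fun k => by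
    change srv (e.symm (req k)) = _
    rw [hsymm]
  refine ⟨S, {
    req := req
    path := fun k => I.stepPath k
    off := fun k => (I.trace k).1
    off_zero := rfl
    off_succ := fun k => rfl
    time_mono := ?_
    ready := ?_
    terminus := ?_
    prompt := ?_ }, fun k => ⟨htime k, rfl⟩⟩
  · intro j k hjk
    rw [htime, htime]
    exact I.stepTime_mono hjk k.2
  · intro k
    rw [htime]
    exact hready k
  · intro k
    rw [hserver]
    exact (halt k).terminus_eq
  · intro k t hj ht r P hP
    rw [htime] at ht
    -- For the first augmentation there is no earlier time to respect, so `F` is everything;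
    -- afterwards it is the half-line from the preceding augmentation.
    have hF : t ∈ (I.trace k).2 := by
      obtain ⟨k, hk⟩ := k
      cases k with
      | zero => exact Set.mem_univ t
      | succ k =>
        have := hj ⟨k, by omega⟩ (Nat.lt_succ_self k)
        rw [htime] at this
        exact this
    exact absurd ((I.isNext_trace k.2).least.2 ⟨hF, r, P, hP⟩) (not_le.2 ht)

/-- The run of the algorithm on an input. -/
noncomputable def run (I : Instance m) : Solution I := I.exists_run.choose

theorem nonempty_execution_run (I : Instance m) : Nonempty (Execution 3 I I.run) :=
  ⟨I.exists_run.choose_spec.choose⟩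

/-- The solution was obtained by choice; its decisions are expressed through the canonical
`stepTime` and `stepPath`, which can be compared between inputs. -/
theorem decisions_run (I : Instance m) (t : ℝ) : I.run.decisions t =
    {x | ∃ k < m, I.stepTime k ≤ t ∧ ∃ r s, AltPath.origin? (I.stepPath k) = some r ∧
      AltPath.terminus? (I.stepPath k) = some s ∧ x = ((r : ℕ), (s : ℕ), I.stepTime k)} := by
  obtain ⟨X, hX⟩ : ∃ X : Execution 3 I I.run,
      ∀ k : Fin m, I.run.time (X.req k) = I.stepTime k ∧ X.path k = I.stepPath k :=
    I.exists_run.choose_spec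
  ext x
  constructor
  · rintro ⟨r, hr, rfl⟩
    obtain ⟨k, rfl⟩ := (Finite.injective_iff_surjective.1 X.req_injective) r
    refine ⟨k, k.2, ?_, X.req k, I.run.server (X.req k), ?_, ?_, ?_⟩
    · rw [← (hX k).1]; exact hr
    · rw [← (hX k).2]; exact (X.isAlternating k).1.origin_eq
    · rw [← (hX k).2]; exact X.terminus k
    · rw [← (hX k).1]
  · rintro ⟨k, hk, ht, r, s, hr, hs, rfl⟩
    have h1 := (X.isAlternating ⟨k, hk⟩).1.origin_eq
    have h2 := X.terminus ⟨k, hk⟩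
    rw [(hX ⟨k, hk⟩).2] at h1 h2
    dsimp only at h1 h2
    rw [hr, Option.some_inj] at h1
    rw [hs, Option.some_inj] at h2
    have h3 := (hX ⟨k, hk⟩).1
    refine ⟨r, ?_, ?_⟩
    · rw [h1, h3]; exact ht
    · rw [h1, h3, h2]

end Instance

/-! ### Causality: two inputs with a common past. -/

theorem exists_map_eq {α β : Type*} (f : α → β) (L : List β) (h : ∀ y ∈ L, ∃ x, f x = y) :
    ∃ K : List α, K.map f = L := by
  induction L with
  | nil => exact ⟨[], rfl⟩
  | cons y L ih =>
    obtain ⟨x, hx⟩ := h y List.mem_cons_self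
    obtain ⟨K, hK⟩ := ih fun z hz => h z (List.mem_cons_of_mem _ hz)
    exact ⟨x :: K, by rw [List.map_cons, hx, hK]⟩

/-- The edge in a larger input with the same labels. -/
def castEdge (h : m ≤ m') : Fin m × Fin m ↪ Fin m' × Fin m' :=
  (Fin.castLEEmb h).prodMap (Fin.castLEEmb h)

theorem castEdge_apply (h : m ≤ m') (e : Fin m × Fin m) :
    castEdge h e = (Fin.castLE h e.1, Fin.castLE h e.2) := rfl

namespace AltPath

/-- The path in a larger input with the same labels. -/
def cast (h : m ≤ m') (P : AltPath m) : AltPath m' := P.map (castEdge h)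

theorem backEdges_cast (h : m ≤ m') (P : AltPath m) :
    backEdges (P.cast h) = (backEdges P).map (castEdge h) := by
  induction P with
  | nil => rfl
  | cons a P ih =>
    cases P with
    | nil => rfl
    | cons b P =>
      rw [backEdges_cons_cons, List.map_cons, ← ih]
      rfl

theorem origin?_cast (h : m ≤ m') (P : AltPath m) :
    origin? (P.cast h) = (origin? P).map (Fin.castLE h) := by
  cases P <;> rfl

theorem terminus?_cast (h : m ≤ m') (P : AltPath m) :
    terminus? (P.cast h) = (terminus? P).map (Fin.castLE h) := by
  unfold terminus? cast
  rw [List.getLast?_map, Option.map_map, Option.map_map]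
  rfl

theorem code_cast (h : m ≤ m') (P : AltPath m) : (P.cast h).code = P.code := by
  unfold code cast
  rw [List.map_map]
  rfl

theorem map_fst_cast (h : m ≤ m') (P : AltPath m) :
    (P.cast h).map Prod.fst = (P.map Prod.fst).map (Fin.castLE h) := by
  unfold cast
  rw [List.map_map, List.map_map]
  rfl

theorem map_snd_cast (h : m ≤ m') (P : AltPath m) :
    (P.cast h).map Prod.snd = (P.map Prod.snd).map (Fin.castLE h) := by
  unfold cast
  rw [List.map_map, List.map_map]
  rfl

theorem edges_cast (h : m ≤ m') (P : AltPath m) :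
    edges (P.cast h) = (edges P).map (castEdge h) := by
  unfold edges
  rw [backEdges_cast, Finset.map_union]
  ext e
  simp [cast]

end AltPath

theorem castLE_eq_iff {h : m ≤ m'} {a b : Fin m} : Fin.castLE h a = Fin.castLE h b ↔ a = b :=
  (Fin.castLE_injective h).eq_iff

/-- The same elements have arrived by time `t` in the two inputs. -/
structure Instance.Agree (I : Instance m) (I' : Instance m') (h : m ≤ m') (t : ℝ) : Prop where
  req : ∀ r, I.reqTime r ≤ t → I'.reqTime (Fin.castLE h r) = I.reqTime r ∧
    I'.reqPos (Fin.castLE h r) = I.reqPos r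
  req_surj : ∀ r', I'.reqTime r' ≤ t → ∃ r, Fin.castLE h r = r' ∧ I.reqTime r ≤ t
  srv : ∀ s, I.srvTime s ≤ t → I'.srvTime (Fin.castLE h s) = I.srvTime s ∧
    I'.srvPos (Fin.castLE h s) = I.srvPos s
  srv_surj : ∀ s', I'.srvTime s' ≤ t → ∃ s, Fin.castLE h s = s' ∧ I.srvTime s ≤ t

theorem Instance.agree_of_revealed {I : Instance m} {I' : Instance m'} (h : m ≤ m') {t : ℝ}
    (hR : I.revealedRequests t = I'.revealedRequests t)
    (hS : I.revealedServers t = I'.revealedServers t) : I.Agree I' h t := by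
  refine ⟨?_, ?_, ?_, ?_⟩
  · intro r hr
    have : ((r : ℕ), I.reqPos r, I.reqTime r) ∈ I'.revealedRequests t := hR ▸ ⟨r, hr, rfl⟩
    obtain ⟨r', -, hr'⟩ := this
    simp only [Prod.mk.injEq] at hr'
    have : Fin.castLE h r = r' := Fin.ext hr'.1
    rw [this]
    exact ⟨hr'.2.2.symm, hr'.2.1.symm⟩
  · intro r' hr'
    have : ((r' : ℕ), I'.reqPos r', I'.reqTime r') ∈ I.revealedRequests t := hR ▸ ⟨r', hr', rfl⟩
    obtain ⟨r, hr, hrr⟩ := this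
    simp only [Prod.mk.injEq] at hrr
    exact ⟨r, Fin.ext hrr.1.symm, hr⟩
  · intro r hr
    have : ((r : ℕ), I.srvPos r, I.srvTime r) ∈ I'.revealedServers t := hS ▸ ⟨r, hr, rfl⟩
    obtain ⟨r', -, hr'⟩ := this
    simp only [Prod.mk.injEq] at hr'
    have : Fin.castLE h r = r' := Fin.ext hr'.1
    rw [this]
    exact ⟨hr'.2.2.symm, hr'.2.1.symm⟩
  · intro r' hr'
    have : ((r' : ℕ), I'.srvPos r', I'.srvTime r') ∈ I.revealedServers t := hS ▸ ⟨r', hr', rfl⟩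
    obtain ⟨r, hr, hrr⟩ := this
    simp only [Prod.mk.injEq] at hrr
    exact ⟨r, Fin.ext hrr.1.symm, hr⟩

namespace Instance.Agree

variable {I : Instance m} {I' : Instance m'} {h : m ≤ m'} {t u : ℝ}

theorem reqTime_le_iff (H : I.Agree I' h t) (hu : u ≤ t) (r : Fin m) :
    I'.reqTime (Fin.castLE h r) ≤ u ↔ I.reqTime r ≤ u := by
  constructor
  · intro hr
    obtain ⟨r0, hr0, h0⟩ := H.req_surj _ (hr.trans hu)
    rw [castLE_eq_iff] at hr0
    subst hr0
    rwa [(H.req _ h0).1] at hr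
  · intro hr
    rwa [(H.req _ (hr.trans hu)).1]

theorem srvTime_le_iff (H : I.Agree I' h t) (hu : u ≤ t) (s : Fin m) :
    I'.srvTime (Fin.castLE h s) ≤ u ↔ I.srvTime s ≤ u := by
  constructor
  · intro hs
    obtain ⟨s0, hs0, h0⟩ := H.srv_surj _ (hs.trans hu)
    rw [castLE_eq_iff] at hs0
    subst hs0
    rwa [(H.srv _ h0).1] at hs
  · intro hs
    rwa [(H.srv _ (hs.trans hu)).1]

theorem dist_eq (H : I.Agree I' h t) {r s : Fin m} (hr : I.reqTime r ≤ t) (hs : I.srvTime s ≤ t) :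
    I'.dist (Fin.castLE h r) (Fin.castLE h s) = I.dist r s := by
  unfold Instance.dist
  rw [(H.req r hr).1, (H.req r hr).2, (H.srv s hs).1, (H.srv s hs).2]

variable {M : Finset (Fin m × Fin m)}

theorem isAugPath_cast_iff (H : I.Agree I' h t) (hu : u ≤ t) {r : Fin m} {P : AltPath m} :
    I'.IsAugPath (M.map (castEdge h)) u (Fin.castLE h r) (P.cast h) ↔ I.IsAugPath M u r P := by
  have hreq : I'.FreeRequest (M.map (castEdge h)) u (Fin.castLE h r) ↔ I.FreeRequest M u r := by
    unfold Instance.FreeRequest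
    rw [H.reqTime_le_iff hu]
    refine and_congr_right fun _ => ?_
    rw [Finset.forall_mem_map]
    simp only [castEdge_apply, ne_eq, castLE_eq_iff]
  have hsrv : ∀ s, I'.FreeServer (M.map (castEdge h)) u (Fin.castLE h s) ↔ I.FreeServer M u s := by
    intro s
    unfold Instance.FreeServer
    rw [H.srvTime_le_iff hu]
    refine and_congr_right fun _ => ?_
    rw [Finset.forall_mem_map]
    simp only [castEdge_apply, ne_eq, castLE_eq_iff]
  have horigin : AltPath.origin? (P.cast h) = some (Fin.castLE h r) ↔
      AltPath.origin? P = some r := by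
    rw [AltPath.origin?_cast, Option.map_eq_some_iff]
    simp only [castLE_eq_iff, exists_eq_right]
  have hterm : (∃ s, AltPath.terminus? (P.cast h) = some s ∧
      I'.FreeServer (M.map (castEdge h)) u s) ↔
      ∃ s, AltPath.terminus? P = some s ∧ I.FreeServer M u s := by
    rw [AltPath.terminus?_cast]
    constructor
    · rintro ⟨s, hs, hf⟩
      obtain ⟨s0, hs0, rfl⟩ := Option.map_eq_some_iff.1 hs
      exact ⟨s0, hs0, (hsrv s0).1 hf⟩
    · rintro ⟨s, hs, hf⟩
      exact ⟨Fin.castLE h s, by rw [hs]; rfl, (hsrv s).2 hf⟩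
  have hfst : ((P.cast h).map Prod.fst).Nodup ↔ (P.map Prod.fst).Nodup := by
    rw [AltPath.map_fst_cast, List.nodup_map_iff (Fin.castLE_injective h)]
  have hsnd : ((P.cast h).map Prod.snd).Nodup ↔ (P.map Prod.snd).Nodup := by
    rw [AltPath.map_snd_cast, List.nodup_map_iff (Fin.castLE_injective h)]
  have hnot : (∀ e ∈ P.cast h, e ∉ M.map (castEdge h)) ↔ ∀ e ∈ P, e ∉ M := by
    unfold AltPath.cast
    rw [List.forall_mem_map]
    simp only [Finset.mem_map']
  have hmem : (∀ e ∈ AltPath.backEdges (P.cast h), e ∈ M.map (castEdge h)) ↔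
      ∀ e ∈ AltPath.backEdges P, e ∈ M := by
    rw [AltPath.backEdges_cast, List.forall_mem_map]
    simp only [Finset.mem_map']
  constructor
  · rintro ⟨h1, h2, h3, h4, h5, h6, h7⟩
    exact ⟨horigin.1 h1, hreq.1 h2, hterm.1 h3, hfst.1 h4, hsnd.1 h5, hnot.1 h6, hmem.1 h7⟩
  · rintro ⟨h1, h2, h3, h4, h5, h6, h7⟩
    exact ⟨horigin.2 h1, hreq.2 h2, hterm.2 h3, hfst.2 h4, hsnd.2 h5, hnot.2 h6, hmem.2 h7⟩

/-- The ends of the path have arrived and so occur in both inputs; all other vertices are saturated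
by a matching that comes from the smaller input. -/
theorem exists_cast_of_isAugPath (H : I.Agree I' h t) (hu : u ≤ t) {r' : Fin m'} {P' : AltPath m'}
    (hP : I'.IsAugPath (M.map (castEdge h)) u r' P') :
    ∃ (r : Fin m) (P : AltPath m), r' = Fin.castLE h r ∧ P' = P.cast h := by
  obtain ⟨s', hs, -, h1, h2⟩ := Instance.isAugPath_iff.1 hP
  obtain ⟨r, rfl, -⟩ := H.req_surj r' (h1.trans hu)
  obtain ⟨s, rfl, -⟩ := H.srv_surj s' (h2.trans hu)
  obtain ⟨P, hPP⟩ := exists_map_eq (castEdge h) P' (by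
    intro e he
    have ha : ∃ a, Fin.castLE h a = e.1 := by
      rcases AltPath.origin?_or_backEdges P' e he with h' | ⟨f, hf, hfe⟩
      · rw [hs.origin_eq, Option.some_inj] at h'
        exact ⟨r, h'⟩
      · obtain ⟨f, -, rfl⟩ := Finset.mem_map.1 (hs.mem f hf)
        exact ⟨f.1, hfe⟩
    have hb : ∃ b, Fin.castLE h b = e.2 := by
      rcases AltPath.terminus?_or_backEdges P' e he with h' | ⟨f, hf, hfe⟩
      · rw [hs.terminus_eq, Option.some_inj] at h'
        exact ⟨s, h'⟩
      · obtain ⟨f, -, rfl⟩ := Finset.mem_map.1 (hs.mem f hf)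
        exact ⟨f.2, hfe⟩
    obtain ⟨a, ha⟩ := ha
    obtain ⟨b, hb⟩ := hb
    exact ⟨(a, b), Prod.ext ha hb⟩)
  exact ⟨r, P, rfl, hPP.symm⟩

theorem netCost_cast (H : I.Agree I' h t) (hu : u ≤ t)
    (hM : ∀ e ∈ M, I.reqTime e.1 ≤ u ∧ I.srvTime e.2 ≤ u) {r : Fin m} {P : AltPath m}
    (hP : I.IsAugPath M u r P) (γ : ℝ) : I'.netCost γ (P.cast h) = I.netCost γ P := by
  obtain ⟨s, hs, -, h1, h2⟩ := Instance.isAugPath_iff.1 hP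
  have hfwd : ∀ e ∈ P, I'.dist (castEdge h e).1 (castEdge h e).2 = I.dist e.1 e.2 := by
    intro e he
    refine H.dist_eq (le_trans ?_ hu) (le_trans ?_ hu)
    · rcases AltPath.origin?_or_backEdges P e he with h' | ⟨f, hf, hfe⟩
      · rw [hs.origin_eq, Option.some_inj] at h'
        rwa [← h']
      · rw [← hfe]; exact (hM f (hs.mem f hf)).1
    · rcases AltPath.terminus?_or_backEdges P e he with h' | ⟨f, hf, hfe⟩
      · rw [hs.terminus_eq, Option.some_inj] at h'
        rwa [← h']
      · rw [← hfe]; exact (hM f (hs.mem f hf)).2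
  have hback : ∀ e ∈ AltPath.backEdges P,
      I'.dist (castEdge h e).1 (castEdge h e).2 = I.dist e.1 e.2 := by
    intro e he
    have := hM e (hs.mem e he)
    exact H.dist_eq (this.1.trans hu) (this.2.trans hu)
  unfold Instance.netCost
  rw [AltPath.backEdges_cast]
  unfold AltPath.cast
  rw [List.map_map, List.map_map]
  congr 2
  · exact congrArg List.sum (List.map_congr_left hfwd)
  · exact List.map_congr_left hback

theorem isReady_cast_iff (H : I.Agree I' h t) (hu : u ≤ t)
    (hM : ∀ e ∈ M, I.reqTime e.1 ≤ u ∧ I.srvTime e.2 ≤ u) {γ : ℝ} {r : Fin m} {P : AltPath m} :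
    I'.IsReady γ (M.map (castEdge h)) u (Fin.castLE h r) (P.cast h) ↔ I.IsReady γ M u r P := by
  have htime : ∀ {Q : AltPath m}, I.IsAugPath M u r Q →
      I'.reqTime (Fin.castLE h r) = I.reqTime r := fun hQ =>
    (H.req r (hQ.free_origin.1.trans hu)).1
  constructor
  · rintro ⟨⟨h1, h2⟩, h3⟩
    rw [H.isAugPath_cast_iff hu] at h1
    rw [htime h1, H.netCost_cast hu hM h1] at h3
    refine ⟨⟨h1, fun Q hQ => ?_⟩, h3⟩
    have := h2 (Q.cast h) ((H.isAugPath_cast_iff hu).2 hQ)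
    rwa [H.netCost_cast hu hM h1, H.netCost_cast hu hM hQ] at this
  · rintro ⟨⟨h1, h2⟩, h3⟩
    refine ⟨⟨(H.isAugPath_cast_iff hu).2 h1, fun Q' hQ' => ?_⟩, ?_⟩
    · obtain ⟨r0, Q, hr0, rfl⟩ := H.exists_cast_of_isAugPath hu hQ'
      rw [castLE_eq_iff] at hr0
      subst hr0
      rw [H.isAugPath_cast_iff hu] at hQ'
      rw [H.netCost_cast hu hM h1, H.netCost_cast hu hM hQ']
      exact h2 Q hQ'
    · rwa [htime h1, H.netCost_cast hu hM h1]

theorem exists_isReady_cast_iff (H : I.Agree I' h t) (hu : u ≤ t)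
    (hM : ∀ e ∈ M, I.reqTime e.1 ≤ u ∧ I.srvTime e.2 ≤ u) {γ : ℝ} :
    (∃ r P, I'.IsReady γ (M.map (castEdge h)) u r P) ↔ ∃ r P, I.IsReady γ M u r P := by
  constructor
  · rintro ⟨r', P', hP⟩
    obtain ⟨r, P, rfl, rfl⟩ := H.exists_cast_of_isAugPath hu hP.1.1
    exact ⟨r, P, (H.isReady_cast_iff hu hM).1 hP⟩
  · rintro ⟨r, P, hP⟩
    exact ⟨_, _, (H.isReady_cast_iff hu hM).2 hP⟩

/-- Whether `τ` is the least ready time depends only on times up to `τ`, where the inputs agree, and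
path codes depend only on labels. -/
theorem isNext_cast_iff (H : I.Agree I' h t) {F : Set ℝ} {τ : ℝ} (hτ : τ ≤ t)
    (hM : ∀ e ∈ M, ∀ u ∈ F, I.reqTime e.1 ≤ u ∧ I.srvTime e.2 ≤ u) {P : AltPath m} :
    I'.IsNext (M.map (castEdge h)) F τ (P.cast h) ↔ I.IsNext M F τ P := by
  have hset : ∀ u ≤ t, (u ∈ F ∧ ∃ r Q, I'.IsReady 3 (M.map (castEdge h)) u r Q) ↔
      (u ∈ F ∧ ∃ r Q, I.IsReady 3 M u r Q) := fun u hu =>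
    and_congr_right fun hF => H.exists_isReady_cast_iff hu fun e he => hM e he u hF
  constructor
  · rintro ⟨⟨h1, h2⟩, ⟨r', h3⟩, h4⟩
    have hMτ := fun e he => hM e he τ h1.1
    obtain ⟨r, Q, rfl, -⟩ := H.exists_cast_of_isAugPath hτ h3.1.1
    refine ⟨⟨(hset τ hτ).1 h1, fun u hu => ?_⟩, ⟨r, (H.isReady_cast_iff hτ hMτ).1 h3⟩, ?_⟩
    · rcases le_total u τ with huτ | huτ
      · exact h2 ((hset u (huτ.trans hτ)).2 hu)
      · exact huτ
    · intro a Q hQ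
      have := h4 _ _ ((H.isReady_cast_iff hτ hMτ).2 hQ)
      rwa [AltPath.code_cast, AltPath.code_cast] at this
  · rintro ⟨⟨h1, h2⟩, ⟨r, h3⟩, h4⟩
    have hMτ := fun e he => hM e he τ h1.1
    refine ⟨⟨(hset τ hτ).2 h1, fun u hu => ?_⟩, ⟨_, (H.isReady_cast_iff hτ hMτ).2 h3⟩, ?_⟩
    · rcases le_total u τ with huτ | huτ
      · exact h2 ((hset u (huτ.trans hτ)).1 hu)
      · exact huτ
    · intro a' Q' hQ'
      obtain ⟨a, Q, rfl, rfl⟩ := H.exists_cast_of_isAugPath hτ hQ'.1.1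
      rw [AltPath.code_cast, AltPath.code_cast]
      exact h4 a Q ((H.isReady_cast_iff hτ hMτ).1 hQ')

theorem step_of_le (H : I.Agree I' h t) {k : ℕ} (hk : k < m)
    (htr : I'.trace k = ((I.trace k).1.map (castEdge h), (I.trace k).2)) (ht : I.stepTime k ≤ t) :
    I'.stepTime k = I.stepTime k ∧ I'.stepPath k = (I.stepPath k).cast h := by
  have hn := (H.isNext_cast_iff ht (I.isState_trace k hk.le).arrived).2 (I.isNext_trace hk)
  have := Instance.next_eq hn
  unfold Instance.stepTime Instance.stepPath at *
  rw [htr]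
  exact ⟨congrArg Prod.fst this, congrArg Prod.snd this⟩

/-- The converse transfer cannot presuppose that the smaller input has a `k`-th step; this follows
because the augmentation found in the larger one pulls back to a ready request. -/
theorem step_of_le' (H : I.Agree I' h t) {k : ℕ} (hkm : k ≤ m) (hk : k < m')
    (htr : I'.trace k = ((I.trace k).1.map (castEdge h), (I.trace k).2))
    (ht : I'.stepTime k ≤ t) : k < m ∧ I.stepTime k ≤ t := by
  have hn := I'.isNext_trace hk
  have hst := I.isState_trace k hkm
  rw [htr] at hn
  obtain ⟨r', hr'⟩ := hn.ready
  obtain ⟨r, P, -, hP⟩ := H.exists_cast_of_isAugPath ht hr'.1.1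
  rw [hP] at hn
  have hn' := (H.isNext_cast_iff ht hst.arrived).1 hn
  refine ⟨hst.lt_of_isNext hn', ?_⟩
  have := Instance.next_eq hn'
  unfold Instance.stepTime at ht ⊢
  rw [this]
  exact ht

theorem trace_cast (H : I.Agree I' h t) : ∀ k ≤ m, (∀ j < k, I.stepTime j ≤ t) →
    I'.trace k = ((I.trace k).1.map (castEdge h), (I.trace k).2) := by
  intro k
  induction k with
  | zero => intro _ _; rfl
  | succ k ih =>
    intro hk hj
    have htr := ih (by omega) fun j hjk => hj j (by omega)
    obtain ⟨h1, h2⟩ := H.step_of_le hk htr (hj k (Nat.lt_succ_self k))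
    rw [Instance.trace_succ, Instance.trace_succ, h1, h2, htr, AltPath.edges_cast,
      Finset.map_eq_image, Finset.map_eq_image, Finset.map_eq_image,
      Finset.image_symmDiff _ _ (castEdge h).injective]

theorem decisions_eq (H : I.Agree I' h t) : I.run.decisions t = I'.run.decisions t := by
  rw [Instance.decisions_run, Instance.decisions_run]
  have hfwd : ∀ k < m, I.stepTime k ≤ t →
      I'.stepTime k = I.stepTime k ∧ I'.stepPath k = (I.stepPath k).cast h := fun k hk ht =>
    H.step_of_le hk (H.trace_cast k hk.le fun j hj => (I.stepTime_mono hj.le hk).trans ht) ht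
  -- Strong induction: the earlier steps of the larger input must already be known to occur by time
  -- `t` in the smaller one before the traces can be identified.
  have hbwd : ∀ k < m', I'.stepTime k ≤ t → k < m ∧ I.stepTime k ≤ t := by
    intro k
    induction k using Nat.strong_induction_on with
    | _ k ih =>
      intro hk ht
      have hprev : ∀ j < k, j < m ∧ I.stepTime j ≤ t := fun j hj =>
        ih j hj (by omega) ((I'.stepTime_mono hj.le hk).trans ht)
      have hkm : k ≤ m := by
        cases k with
        | zero => exact Nat.zero_le _
        | succ k => exact (hprev k (Nat.lt_succ_self k)).1
      exact H.step_of_le' hkm hk (H.trace_cast k hkm fun j hj => (hprev j hj).2) ht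
  ext x
  constructor
  · rintro ⟨k, hk, ht, r, s, hr, hs, rfl⟩
    obtain ⟨h1, h2⟩ := hfwd k hk ht
    refine ⟨k, hk.trans_le h, h1.trans_le ht, Fin.castLE h r, Fin.castLE h s, ?_, ?_, ?_⟩
    · rw [h2, AltPath.origin?_cast, hr]; rfl
    · rw [h2, AltPath.terminus?_cast, hs]; rfl
    · rw [h1]; rfl
  · rintro ⟨k, hk', ht', r', s', hr, hs, rfl⟩
    obtain ⟨hk, ht⟩ := hbwd k hk' ht'
    obtain ⟨h1, h2⟩ := hfwd k hk ht
    rw [h2, AltPath.origin?_cast] at hr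
    rw [h2, AltPath.terminus?_cast] at hs
    obtain ⟨r, hr0, rfl⟩ := Option.map_eq_some_iff.1 hr
    obtain ⟨s, hs0, rfl⟩ := Option.map_eq_some_iff.1 hs
    exact ⟨k, hk, ht, r, s, hr0, hs0, by rw [h1]; rfl⟩

end Instance.Agree

/-! ### The algorithm and the asymptotics of its ratio. -/

/-- The robust matching algorithm with delays, with ties broken by the labels. -/
noncomputable def robustMatching : OnlineAlgorithm where
  run I := I.run
  causal := by
    intro m m' I I' t hR hS
    rcases le_total m m' with h | h
    · exact (Instance.agree_of_revealed h hR hS).decisions_eq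
    · exact (Instance.agree_of_revealed h hR.symm hS.symm).decisions_eq.symm

/-- The competitive ratio obtained in the analysis. -/
noncomputable def competitiveRatio (m : ℕ) : ℝ :=
  5 * (1 + 2592 * (Nat.clog 2 m : ℝ) * (Nat.clog 2 m + 1) * √m)

theorem clog_le_log {m : ℕ} (hm : 2 ≤ m) : (Nat.clog 2 m : ℝ) ≤ 4 * Real.log m := by
  have h1 : 2 ^ (Nat.clog 2 m - 1) < m := Nat.pow_pred_clog_lt_self (by norm_num) hm
  have h2 : 1 ≤ Nat.clog 2 m := Nat.clog_pos (by norm_num) hm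
  have h3 : ((Nat.clog 2 m - 1 : ℕ) : ℝ) * Real.log 2 ≤ Real.log m := by
    rw [← Real.log_pow]
    refine Real.log_le_log (by positivity) ?_
    exact_mod_cast h1.le
  have h4 : Real.log 2 ≤ Real.log m := Real.log_le_log (by norm_num) (by exact_mod_cast hm)
  rw [Nat.cast_sub h2, Nat.cast_one] at h3
  have h5 := Real.log_two_gt_d9
  have h6 : (0 : ℝ) ≤ Nat.clog 2 m := Nat.cast_nonneg _
  nlinarith

theorem isBigO_competitiveRatio : Asymptotics.IsBigO Filter.atTop competitiveRatio
    (fun m : ℕ => Real.sqrt (m : ℝ) * Real.log (m : ℝ) ^ 2) := by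
  -- With L = log m ≥ 1/2: 1 ≤ 4√m L², and the rounded binary logarithm J satisfies J ≤ 4L and J + 1
  -- ≤ 8L.
  refine Asymptotics.IsBigO.of_bound (5 * (4 + 2592 * 4 * 8)) ?_
  filter_upwards [Filter.eventually_ge_atTop 2] with m hm
  have h1 := clog_le_log hm
  have h2 : Real.log 2 ≤ Real.log m := Real.log_le_log (by norm_num) (by exact_mod_cast hm)
  have h3 := Real.log_two_gt_d9
  have h4 : 1 ≤ √(m : ℝ) := by
    rw [Real.one_le_sqrt]
    exact_mod_cast (by omega : 1 ≤ m)
  set L := Real.log m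
  set R := √(m : ℝ)
  set J : ℝ := (Nat.clog 2 m : ℝ) with hJ
  have hJ0 : 0 ≤ J := Nat.cast_nonneg _
  have hL : 1 / 2 ≤ L := by linarith
  rw [Real.norm_of_nonneg (by unfold competitiveRatio; positivity),
    Real.norm_of_nonneg (by positivity)]
  have h5 : J * (J + 1) ≤ 4 * L * (8 * L) :=
    mul_le_mul h1 (by linarith) (by linarith) (by linarith)
  have h6 : 1 ≤ 4 * (R * L ^ 2) := by nlinarith
  unfold competitiveRatio
  rw [← hJ]
  have h7 := mul_le_mul_of_nonneg_right h5 (by linarith : 0 ≤ R)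
  change 5 * (1 + 2592 * J * (J + 1) * R) ≤ _
  linarith

theorem robustMatching_isCompetitive : robustMatching.IsCompetitive competitiveRatio := by
  intro m
  refine ⟨?_, fun I => ?_⟩
  · have : (0 : ℝ) ≤ 2592 * (Nat.clog 2 m : ℝ) * (Nat.clog 2 m + 1) * √m := by positivity
    unfold competitiveRatio
    linarith
  · obtain ⟨X⟩ := I.nonempty_execution_run
    exact X.cost_le_optCost (Nat.le_pow_clog (by norm_num) m)

end MBPMD

/-- There is a deterministic online algorithm for minimum-cost bipartite perfect matching with
delays on the real line, every run of which is an execution of the robust matching algorithm with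
delays (with `γ = 3`), that is `O(√m log² m)`-competitive. -/
theorem theorem1 :
    ∃ A : MBPMD.OnlineAlgorithm,
      (∀ (m : ℕ) (I : MBPMD.Instance m), Nonempty (MBPMD.Execution 3 I (A.run I))) ∧
      ∃ c : ℕ → ℝ,
        Asymptotics.IsBigO Filter.atTop c
          (fun m : ℕ => Real.sqrt (m : ℝ) * Real.log (m : ℝ) ^ 2) ∧
        A.IsCompetitive c :=
  ⟨MBPMD.robustMatching, fun _ I => I.nonempty_execution_run, MBPMD.competitiveRatio,
    MBPMD.isBigO_competitiveRatio, MBPMD.robustMatching_isCompetitive⟩
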